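/- Let $n\ge 0$ be an integer and $t\ge 0$ a real number. Graphs are simple graphs on the node set $\{1,\dots,n+1\}$; $\mathcal C_{n+1}$ is the set of connected ones, and a labeled tree is a connected acyclic graph on this node set, rooted at the node $n+1$. *Neighbors-first search.* Given $G\in\mathcal C_{n+1}$, the node $n+1$ is the first active node and the $0$-th visited node. At each step, visit the previously unvisited neighbors of the active node in decreasing order of their labels; the next active node is the last visited node that has not yet been active. The edges joining each visited node to the active node from which it was visited form a labeled tree $\Phi(G)$. *Cane paths.* In a labeled tree $T$, a cane path is a path of length $k\ge 2$ whose first $k-1$ steps go from a node to its parent and whose last step goes from the node $b$ reached by an up step $a\to b$ to a child $c$ of $b$ with a label larger than that of $a$. For a node $v$ let $j(v)$ be the number of cane paths starting in $v$, and let $\alpha(T)=\sum_v j(v)$. Let $i(v)$ be the position of $v$ in the neighbors-first search of $T$ (the root has position $0$). *Polytopes.* With $x_0=1$, let $$\mathbf C_n(t)=\{(x_1,\dots,x_n)\in\mathbb R^n : 1\le x_i\le (1+t)x_{i-1}\ \text{for } i=1,\dots,n\},$$ and for a labeled tree $T$ let $$\mathbf S_T(t)=\Bigl\{(x_1,\dots,x_n)\in\mathbb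 R^n : 1\le \frac{x_{i(1)}}{(1+t)^{j(1)}}\le \frac{x_{i(2)}}{(1+t)^{j(2)}}\le\dots\le \frac{x_{i(n)}}{(1+t)^{j(n)}}\le 1+t\Bigr\}.$$ **Theorem.** For every labeled tree $T$ on $n+1$ nodes, the set $\mathbf S_T(t)$ is a simplex (an $n$-simplex if $t>0$), and $$n!\,\operatorname{vol}\mathbf S_T(t)=\sum_{G\in\mathcal C_{n+1},\ \Phi(G)=T}t^{|E(G)|}=t^n(1+t)^{\alpha(T)}.$$ Furthermore, if $t>0$, the simplices $\mathbf S_T(t)$, indexed by all labeled trees $T$ on $n+1$ nodes, triangulate $\mathbf C_n(t)$: they are $n$-simplices with pairwise disjoint interiors, their union is $\mathbf C_n(t)$, and any two of them meet in a common (possibly empty) face. In particular, for all $t\ge 0$, $$n!\,\operatorname{vol}\mathbf C_n(t)=\sum_{G\in\mathcal C_{n+1}}t^{|E(G)|}.$$ (Here $0^0=1$.) -/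

import Mathlib

open MeasureTheory
open scoped Nat ENNReal

namespace CayleyPolytope

/-! Nodes of a graph on `n + 1` nodes are the elements of `Fin (n + 1)`; the node `k : Fin (n + 1)`
carries the label `k + 1`.  The node with the maximal label is `Fin.last n`; it is the root of every
labeled tree and the starting node of the search. -/

/-- State of the neighbors-first search.  `visited` lists the visited nodes in the order of their
visits; `pending` lists the visited nodes that have not been active yet, the last visited one first;
`arcs` lists the pairs (active node, node visited from it). -/
structure NFSState (n : ℕ) where
  visited : List (Fin (n + 1))
  pending : List (Fin (n + 1))
  arcs : List (Fin (n + 1) × Fin (n + 1))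

open Classical in
/-- The unvisited neighbors of `v` in decreasing order of their labels. -/
noncomputable def newNeighbors {n : ℕ} (G : SimpleGraph (Fin (n + 1))) (visited : List (Fin (n + 1)))
    (v : Fin (n + 1)) : List (Fin (n + 1)) :=
  (List.finRange (n + 1)).reverse.filter (fun w => decide (G.Adj v w ∧ w ∉ visited))

/-- One step of the search: the last visited node `v` that has not been active becomes the active
node (if `v` was just visited from the previous active node, it is the one with the smallest label;
otherwise this is backtracking), and its unvisited neighbors are visited in decreasing order of their
labels. -/
noncomputable def nfsStep {n : ℕ} (G : SimpleGraph (Fin (n + 1))) (s : NFSState n) : NFSState n :=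
  match s.pending with
  | [] => s
  | v :: rest =>
    { visited := s.visited ++ newNeighbors G s.visited v
      pending := (newNeighbors G s.visited v).reverse ++ rest
      arcs := s.arcs ++ (newNeighbors G s.visited v).map (fun w => (v, w)) }

/-- The final state of the search, started at the node with the maximal label.  Each step uses up one
active node, so `n + 1` steps suffice. -/
noncomputable def nfs {n : ℕ} (G : SimpleGraph (Fin (n + 1))) : NFSState n :=
  (nfsStep G)^[n + 1] { visited := [Fin.last n], pending := [Fin.last n], arcs := [] }

/-- The search tree `Φ(G)`: its edges join each visited node to the active node it was visited
from. -/
noncomputable def searchTree {n : ℕ} (G : SimpleGraph (Fin (n + 1))) : SimpleGraph (Fin (n + 1)) :=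
  SimpleGraph.fromRel (fun v w => (v, w) ∈ (nfs G).arcs)

/-- The position of a node in the search; the root has position `0`. -/
noncomputable def nfsPosition {n : ℕ} (G : SimpleGraph (Fin (n + 1))) (v : Fin (n + 1)) : ℕ :=
  (nfs G).visited.idxOf v

/-- In the tree `T` rooted at the node with the maximal label, `u` is the parent of `v`. -/
def IsParent {n : ℕ} (T : SimpleGraph (Fin (n + 1))) (u v : Fin (n + 1)) : Prop :=
  T.Adj u v ∧ T.dist (Fin.last n) v = T.dist (Fin.last n) u + 1

/-- Cane paths, as lists of nodes: paths of length `k ≥ 2` whose first `k - 1` steps are up (from a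
node to its parent) and whose last step is down right, that is, from a node `b` just reached by an up
step `a → b` to a child `c` of `b` whose label is larger than that of `a`. -/
inductive IsCanePath {n : ℕ} (T : SimpleGraph (Fin (n + 1))) : List (Fin (n + 1)) → Prop
  | base {a b c : Fin (n + 1)} (hup : IsParent T b a) (hdown : IsParent T b c) (hright : a < c) :
      IsCanePath T [a, b, c]
  | up {a b : Fin (n + 1)} {l : List (Fin (n + 1))} (hup : IsParent T b a)
      (h : IsCanePath T (b :: l)) : IsCanePath T (a :: b :: l)

/-- The number of cane paths in `T` that start in `v`. -/
noncomputable def caneCount {n : ℕ} (T : SimpleGraph (Fin (n + 1))) (v : Fin (n + 1)) : ℕ :=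
  {p : List (Fin (n + 1)) | IsCanePath T p ∧ p.head? = some v}.ncard

/-- The statistic `α(T)`, the sum over all nodes `v` of the number of cane paths starting in `v`. -/
noncomputable def alpha {n : ℕ} (T : SimpleGraph (Fin (n + 1))) : ℕ :=
  ∑ v, caneCount T v

/-- The coordinates `x_1, …, x_n` of a point, indexed from `1`, together with `x_0 = 1`.
(The value at indices above `n` plays no role.) -/
def coord {n : ℕ} (x : Fin n → ℝ) : ℕ → ℝ
  | 0 => 1
  | i + 1 => if h : i < n then x ⟨i, h⟩ else 0

/-- The coordinate `x_i / (1 + t) ^ j` attached to the node `v` of `T`. -/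
noncomputable def nodeCoord {n : ℕ} (T : SimpleGraph (Fin (n + 1))) (t : ℝ) (x : Fin n → ℝ)
    (v : Fin (n + 1)) : ℝ :=
  coord x (nfsPosition T v) / (1 + t) ^ caneCount T v

/-- The set `S_T(t)`: the coordinates attached to the nodes with labels `1, …, n`, in this order,
form a weakly increasing sequence of numbers between `1` and `1 + t`. -/
def treeSimplex {n : ℕ} (T : SimpleGraph (Fin (n + 1))) (t : ℝ) : Set (Fin n → ℝ) :=
  {x | (∀ k : Fin n, 1 ≤ nodeCoord T t x k.castSucc ∧ nodeCoord T t x k.castSucc ≤ 1 + t) ∧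
    Monotone (fun k : Fin n => nodeCoord T t x k.castSucc)}

/-- The `t`-Cayley polytope: `1 ≤ x_i ≤ (1 + t) x_{i-1}` for `i = 1, …, n`, where `x_0 = 1`.
(`x i` is the coordinate number `i + 1`, and `coord x i` the coordinate number `i`.) -/
def cayleyPolytope (n : ℕ) (t : ℝ) : Set (Fin n → ℝ) :=
  {x | ∀ i : Fin n, 1 ≤ x i ∧ x i ≤ (1 + t) * coord x i}

/-- A `d`-simplex: the convex hull of `d + 1` affinely independent points. -/
def IsSimplex {n : ℕ} (d : ℕ) (s : Set (Fin n → ℝ)) : Prop :=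
  ∃ p : Fin (d + 1) → (Fin n → ℝ), AffineIndependent ℝ p ∧ s = convexHull ℝ (Set.range p)

/-- The sets `S i` triangulate `P ⊆ ℝⁿ`: they are `n`-simplices with pairwise disjoint interiors and
union `P`, and any two of them meet in a common (possibly empty) face.  (The intersection is convex,
and the faces of a simplex are its convex extreme subsets.) -/
structure IsTriangulation {n : ℕ} {ι : Type*} (S : ι → Set (Fin n → ℝ)) (P : Set (Fin n → ℝ)) :
    Prop where
  finite : Finite ι
  simplex : ∀ i, IsSimplex n (S i)
  iUnion_eq : ⋃ i, S i = P
  disjoint_interior : Pairwise (fun i j => Disjoint (interior (S i)) (interior (S j)))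
  inter_face : ∀ i j, IsExtreme ℝ (S i) (S i ∩ S j) ∧ IsExtreme ℝ (S j) (S i ∩ S j)

open Classical in
/-- The generating function by number of edges of the connected graphs `G` on `n + 1` labeled nodes
that satisfy `p G`. -/
noncomputable def connectedEdgeSum (n : ℕ) (t : ℝ) (p : SimpleGraph (Fin (n + 1)) → Prop) : ℝ :=
  ∑ G : SimpleGraph (Fin (n + 1)) with G.Connected ∧ p G, t ^ G.edgeSet.ncard

end CayleyPolytope

namespace CayleyPolytope

/-! The search is a stack machine, and everything rests on one fact about its run on a tree `T`.
When `v` is on top of the stack, the nodes below it are in bijection with the cane paths starting in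
`v`, each path ending in its node. Indeed the children of an active node `u` replace `u` on the
stack with the smallest label on top. Below a child `v` lie its larger siblings, which give the cane
paths of length two, and whatever was below `u`, which gives the cane paths of `u` prolonged by the
step from `v` up to `u`.

Generating function of a fiber: when `v` is active in the search of `G`, an edge to an unvisited
node enters the search tree, while an edge to a node waiting in the stack is ignored. So `Φ(G) = T`
means that `G` is `T` plus an arbitrary set of edges `vw` with `w` below `v` in the stack when `v`
is active. There are `α(T)` such pairs, and the binomial theorem gives `t ^ n * (1 + t) ^ α(T)`. On
the other side, `S_T(t)` is the order simplex, of volume `t ^ n / n!`, with coordinates permuted and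
stretched by the factors `(1 + t) ^ j(v)`.

Triangulation: a tree is coded by its visiting order `ρ` and the cane counts `μ` along it. The codes
that occur are those with `μ` starting at 0 and, at each step, either not rising or rising by
exactly 1 with a drop of label. Put `q = 1 + t`. For a point `x` of the polytope, `μ i` is
essentially the integer part of `log_q (x i)`, and `ρ` sorts the fractional parts; the condition `x
(i + 1) ≤ q * x i` is then the code condition. Hence the simplices cover the polytope. They are cut
out by hyperplanes `x i = q ^ k` and `x i = q ^ k * x j` with `k` an integer. No simplex crosses
such a hyperplane, so two of them meet in a common face, and a point off all these hyperplanes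
determines its code. Summing over trees gives the volume of the polytope for `t > 0`; `t = 0` is
checked directly. -/

variable {n : ℕ}

/-! ### Stack-driven searches with arbitrary blocks: the search of a graph and the decoding of a
code are both instances. -/

/-- One step of a stack-driven search in which the nodes visited from the active node `v`, given the
list `l` of nodes visited before, are `B l v`. -/
def searchStep (B : List (Fin (n + 1)) → Fin (n + 1) → List (Fin (n + 1))) (s : NFSState n) :
    NFSState n :=
  match s.pending with
  | [] => s
  | v :: rest =>
    { visited := s.visited ++ B s.visited v
      pending := (B s.visited v).reverse ++ rest
      arcs := s.arcs ++ (B s.visited v).map (fun w => (v, w)) }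

/-- The state of the search after `k` steps. -/
def searchState (B : List (Fin (n + 1)) → Fin (n + 1) → List (Fin (n + 1))) (k : ℕ) : NFSState n :=
  (searchStep B)^[k] { visited := [Fin.last n], pending := [Fin.last n], arcs := [] }

theorem nfsStep_eq_searchStep (G : SimpleGraph (Fin (n + 1))) :
    nfsStep G = searchStep (newNeighbors G) := by
  funext s
  rcases s with ⟨a, p, c⟩
  cases p <;> rfl

theorem nfs_eq_searchState (G : SimpleGraph (Fin (n + 1))) :
    nfs G = searchState (newNeighbors G) (n + 1) := by
  rw [nfs, searchState, nfsStep_eq_searchStep]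

/-- Along the search, the blocks consist of unvisited nodes in decreasing order. -/
def Admissible (B : List (Fin (n + 1)) → Fin (n + 1) → List (Fin (n + 1))) : Prop :=
  ∀ k v rest, (searchState B k).pending = v :: rest →
    (B (searchState B k).visited v).Pairwise (· > ·) ∧
      ∀ w ∈ B (searchState B k).visited v, w ∉ (searchState B k).visited

theorem mem_newNeighbors (G : SimpleGraph (Fin (n + 1))) (l : List (Fin (n + 1)))
    (v w : Fin (n + 1)) : w ∈ newNeighbors G l v ↔ G.Adj v w ∧ w ∉ l := by
  simp [newNeighbors]

theorem newNeighbors_pairwise (G : SimpleGraph (Fin (n + 1))) (l : List (Fin (n + 1)))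
    (v : Fin (n + 1)) : (newNeighbors G l v).Pairwise (· > ·) := by
  unfold newNeighbors
  apply List.Pairwise.filter
  rw [List.pairwise_reverse]
  exact List.pairwise_lt_finRange _

theorem admissible_newNeighbors (G : SimpleGraph (Fin (n + 1))) :
    Admissible (newNeighbors G) := fun _ _ _ _ =>
  ⟨newNeighbors_pairwise _ _ _, fun w hw => ((mem_newNeighbors G _ _ w).1 hw).2⟩

theorem newNeighbors_eq_of_forall_mem_iff {G : SimpleGraph (Fin (n + 1))} {l B : List (Fin (n + 1))}
    {v : Fin (n + 1)} (hB : B.Pairwise (· > ·)) (h : ∀ w, w ∈ B ↔ G.Adj v w ∧ w ∉ l) :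
    newNeighbors G l v = B :=
  List.Pairwise.eq_of_mem_iff (newNeighbors_pairwise G l v) hB
    (fun w => by rw [mem_newNeighbors, h])

section Search

variable {B : List (Fin (n + 1)) → Fin (n + 1) → List (Fin (n + 1))}

@[simp] theorem searchState_zero :
    searchState B 0 = { visited := [Fin.last n], pending := [Fin.last n], arcs := [] } := rfl

theorem searchState_succ (k : ℕ) : searchState B (k + 1) = searchStep B (searchState B k) := by
  simp only [searchState, Function.iterate_succ_apply']

theorem searchState_succ_of_nil {k : ℕ} (h : (searchState B k).pending = []) :
    searchState B (k + 1) = searchState B k := by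
  rw [searchState_succ, searchStep, h]

theorem searchState_succ_of_cons {k : ℕ} {v : Fin (n + 1)} {rest : List (Fin (n + 1))}
    (h : (searchState B k).pending = v :: rest) :
    searchState B (k + 1) =
      { visited := (searchState B k).visited ++ B (searchState B k).visited v
        pending := (B (searchState B k).visited v).reverse ++ rest
        arcs := (searchState B k).arcs ++ (B (searchState B k).visited v).map (fun w => (v, w)) } := by
  rw [searchState_succ, searchStep, h]

/-- An induction principle for properties of the states of a search. -/
theorem searchState_induction {P : ℕ → NFSState n → Prop}
    (zero : P 0 { visited := [Fin.last n], pending := [Fin.last n], arcs := [] })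
    (nil : ∀ k, (searchState B k).pending = [] → P k (searchState B k) →
      P (k + 1) (searchState B k))
    (cons : ∀ k v rest, (searchState B k).pending = v :: rest → P k (searchState B k) →
      P (k + 1)
        { visited := (searchState B k).visited ++ B (searchState B k).visited v
          pending := (B (searchState B k).visited v).reverse ++ rest
          arcs := (searchState B k).arcs ++
            (B (searchState B k).visited v).map (fun w => (v, w)) })
    (k : ℕ) : P k (searchState B k) := by
  induction k with
  | zero => exact zero
  | succ k ih =>
    rcases hp : (searchState B k).pending with _ | ⟨v, rest⟩
    · rw [searchState_succ_of_nil hp]; exact nil k hp ih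
    · rw [searchState_succ_of_cons hp]; exact cons k v rest hp ih

theorem visited_eq (k : ℕ) :
    (searchState B k).visited = Fin.last n :: (searchState B k).arcs.map Prod.snd := by
  refine searchState_induction (P := fun _ s => s.visited = Fin.last n :: s.arcs.map Prod.snd)
    ?_ ?_ ?_ k
  · simp
  · intro k _ h; exact h
  · intro k v rest _ h
    simp only [List.map_append, List.map_map]
    rw [← List.cons_append, ← h]
    congr 1
    simp [Function.comp_def]

theorem pending_subset_visited (k : ℕ) : (searchState B k).pending ⊆ (searchState B k).visited := by
  refine searchState_induction (P := fun _ s => s.pending ⊆ s.visited) ?_ ?_ ?_ k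
  · simp
  · intro k _ h; exact h
  · intro k v rest hp h w hw
    rw [hp] at h
    simp only [List.mem_append, List.mem_reverse] at hw ⊢
    rcases hw with hw | hw
    · exact Or.inr hw
    · exact Or.inl (h (List.mem_cons_of_mem _ hw))

theorem visited_prefix {i j : ℕ} (hij : i ≤ j) :
    (searchState B i).visited <+: (searchState B j).visited := by
  induction j, hij using Nat.le_induction with
  | base => exact List.prefix_rfl
  | succ j _ ih =>
    refine ih.trans ?_
    rcases hp : (searchState B j).pending with _ | ⟨v, rest⟩
    · rw [searchState_succ_of_nil hp]
    · rw [searchState_succ_of_cons hp]; exact List.prefix_append _ _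

theorem arcs_prefix {i j : ℕ} (hij : i ≤ j) :
    (searchState B i).arcs <+: (searchState B j).arcs := by
  induction j, hij using Nat.le_induction with
  | base => exact List.prefix_rfl
  | succ j _ ih =>
    refine ih.trans ?_
    rcases hp : (searchState B j).pending with _ | ⟨v, rest⟩
    · rw [searchState_succ_of_nil hp]
    · rw [searchState_succ_of_cons hp]; exact List.prefix_append _ _

theorem last_mem_visited (k : ℕ) : Fin.last n ∈ (searchState B k).visited := by
  rw [visited_eq]; exact List.mem_cons_self

theorem exists_of_mem_arcs {k : ℕ} {v w : Fin (n + 1)} (h : (v, w) ∈ (searchState B k).arcs) :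
    ∃ l < k, ∃ rest, (searchState B l).pending = v :: rest ∧ w ∈ B (searchState B l).visited v := by
  induction k with
  | zero => simp at h
  | succ k ih =>
    rcases hp : (searchState B k).pending with _ | ⟨u, rest⟩
    · rw [searchState_succ_of_nil hp] at h
      obtain ⟨l, hl, h⟩ := ih h
      exact ⟨l, by omega, h⟩
    · rw [searchState_succ_of_cons hp] at h
      simp only [List.mem_append, List.mem_map, Prod.mk.injEq] at h
      rcases h with h | ⟨x, hx, rfl, rfl⟩
      · obtain ⟨l, hl, h⟩ := ih h
        exact ⟨l, by omega, h⟩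
      · exact ⟨k, by omega, rest, hp, hx⟩

theorem mem_arcs_succ {k : ℕ} {v w : Fin (n + 1)} {rest : List (Fin (n + 1))}
    (hp : (searchState B k).pending = v :: rest) (hw : w ∈ B (searchState B k).visited v) :
    (v, w) ∈ (searchState B (k + 1)).arcs := by
  rw [searchState_succ_of_cons hp]; simp [hw]

theorem exists_pending_of_mem_visited {k : ℕ} {v : Fin (n + 1)}
    (h : v ∈ (searchState B k).visited) : ∃ j ≤ k, v ∈ (searchState B j).pending := by
  induction k with
  | zero => exact ⟨0, le_rfl, by simpa using h⟩
  | succ k ih =>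
    rcases hp : (searchState B k).pending with _ | ⟨u, rest⟩
    · rw [searchState_succ_of_nil hp] at h
      obtain ⟨l, hl, h⟩ := ih h
      exact ⟨l, by omega, h⟩
    · rw [searchState_succ_of_cons hp] at h
      rcases List.mem_append.1 h with h | h
      · obtain ⟨l, hl, h⟩ := ih h
        exact ⟨l, by omega, h⟩
      · exact ⟨k + 1, le_rfl, by rw [searchState_succ_of_cons hp]; simp [h]⟩

theorem exists_active_of_pending {i j : ℕ} (hij : i ≤ j) {v : Fin (n + 1)}
    (h : v ∈ (searchState B i).pending) (h' : v ∉ (searchState B j).pending) :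
    ∃ k, i ≤ k ∧ k < j ∧ ∃ rest, (searchState B k).pending = v :: rest := by
  induction j, hij using Nat.le_induction with
  | base => exact absurd h h'
  | succ j hj ih =>
    by_cases hv : v ∈ (searchState B j).pending
    · rcases hp : (searchState B j).pending with _ | ⟨u, rest⟩
      · simp [hp] at hv
      · rw [searchState_succ_of_cons hp] at h'
        rw [hp] at hv
        simp only [List.mem_append, not_or] at h'
        rcases List.mem_cons.1 hv with rfl | hv
        · exact ⟨j, hj, by omega, rest, hp⟩
        · exact absurd hv h'.2
    · obtain ⟨k, h1, h2, h3⟩ := ih hv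
      exact ⟨k, h1, by omega, h3⟩

theorem reachable_of_mem_visited {k : ℕ} {H : SimpleGraph (Fin (n + 1))}
    (hH : ∀ v w, (v, w) ∈ (searchState B k).arcs → H.Adj v w) {w : Fin (n + 1)}
    (hw : w ∈ (searchState B k).visited) : H.Reachable (Fin.last n) w := by
  induction k generalizing w with
  | zero =>
    have : w = Fin.last n := by simpa using hw
    rw [this]
  | succ k ih =>
    have ih' := fun w => ih (w := w)
      (fun v w h => hH v w ((arcs_prefix (Nat.le_succ k)).subset h))
    rcases hp : (searchState B k).pending with _ | ⟨u, rest⟩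
    · rw [searchState_succ_of_nil hp] at hw
      exact ih' w hw
    · have hu : u ∈ (searchState B k).visited := pending_subset_visited k (by simp [hp])
      rw [searchState_succ_of_cons hp] at hw
      rcases List.mem_append.1 hw with h | h
      · exact ih' w h
      · exact (ih' u hu).trans (hH u w (mem_arcs_succ hp h)).reachable

/-- Each step removes one node from the stack, so after `k` steps exactly `k` visited nodes have
been active. Once the stack is empty the state is frozen while `k` keeps growing. This bounds the
number of steps by `n + 1`. -/
theorem visited_length (k : ℕ) (h : (searchState B k).pending ≠ []) :
    (searchState B k).visited.length = k + (searchState B k).pending.length := by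
  revert h
  refine searchState_induction
    (P := fun k s => s.pending ≠ [] → s.visited.length = k + s.pending.length) ?_ ?_ ?_ k
  · simp
  · intro k h _ h'; exact absurd h h'
  · intro k v rest hp h _
    have := h (by simp [hp])
    rw [hp] at this
    simp only [List.length_append, List.length_reverse, this, List.length_cons]
    omega

variable (hB : Admissible B)
include hB

theorem visited_nodup (k : ℕ) : (searchState B k).visited.Nodup := by
  refine searchState_induction (P := fun _ s => s.visited.Nodup) ?_ ?_ ?_ k
  · simp
  · intro k _ h; exact h
  · intro k v rest hp h
    obtain ⟨h1, h2⟩ := hB k v rest hp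
    exact h.append (h1.imp (fun h => ne_of_gt h)) (fun w hw hw' => h2 w hw' hw)

theorem pending_nodup (k : ℕ) : (searchState B k).pending.Nodup := by
  refine searchState_induction (P := fun _ s => s.pending.Nodup) ?_ ?_ ?_ k
  · simp
  · intro k _ h; exact h
  · intro k v rest hp h
    obtain ⟨h1, h2⟩ := hB k v rest hp
    have hsub := pending_subset_visited (B := B) k
    rw [hp] at h hsub
    have hnd : (B (searchState B k).visited v).Nodup := h1.imp (fun h => ne_of_gt h)
    refine List.Nodup.append (List.nodup_reverse.2 hnd) (List.nodup_cons.1 h).2 (fun w hw hw' => ?_)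
    exact h2 w (List.mem_reverse.1 hw) (hsub (List.mem_cons_of_mem _ hw'))

theorem not_mem_pending_of_le {i j : ℕ} (hij : i ≤ j) {v : Fin (n + 1)}
    (hv : v ∈ (searchState B i).visited) (hp : v ∉ (searchState B i).pending) :
    v ∉ (searchState B j).pending := by
  induction j, hij using Nat.le_induction with
  | base => exact hp
  | succ j hj ih =>
    rcases hq : (searchState B j).pending with _ | ⟨u, rest⟩
    · rwa [searchState_succ_of_nil hq]
    · rw [searchState_succ_of_cons hq]
      rw [hq] at ih
      obtain ⟨h1, h2⟩ := hB j u rest hq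
      simp only [List.mem_append, List.mem_reverse, not_or]
      exact ⟨fun h => h2 v h ((visited_prefix hj).subset hv), fun h => ih (List.mem_cons_of_mem _ h)⟩

theorem not_mem_pending_of_active {i j : ℕ} (hij : i < j) {v : Fin (n + 1)}
    {rest : List (Fin (n + 1))} (h : (searchState B i).pending = v :: rest) :
    v ∉ (searchState B j).pending := by
  have hv : v ∈ (searchState B i).visited := pending_subset_visited i (by simp [h])
  apply not_mem_pending_of_le hB (Nat.succ_le_of_lt hij)
  · exact (visited_prefix (Nat.le_succ i)).subset hv
  · rw [Nat.succ_eq_add_one, searchState_succ_of_cons h]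
    obtain ⟨h1, h2⟩ := hB i v rest h
    have := pending_nodup hB i
    rw [h] at this
    simp only [List.mem_append, List.mem_reverse, not_or]
    exact ⟨fun h => h2 v h hv, (List.nodup_cons.1 this).1⟩

theorem active_unique {i j : ℕ} {v : Fin (n + 1)} {r r' : List (Fin (n + 1))}
    (h : (searchState B i).pending = v :: r) (h' : (searchState B j).pending = v :: r') :
    i = j := by
  rcases lt_trichotomy i j with hij | hij | hij
  · exact absurd (by simp [h']) (not_mem_pending_of_active hB hij h)
  · exact hij
  · exact absurd (by simp [h]) (not_mem_pending_of_active hB hij h')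

theorem pending_eq_nil {k : ℕ} (hk : n + 1 ≤ k) : (searchState B k).pending = [] := by
  by_contra h
  have h1 := visited_length k h
  have h2 := (visited_nodup hB k).length_le_card
  rw [Fintype.card_fin] at h2
  have := List.length_pos_of_ne_nil h
  omega

theorem lt_of_pending {k : ℕ} (h : (searchState B k).pending ≠ []) : k < n + 1 := by
  by_contra h'
  exact h (pending_eq_nil hB (not_lt.1 h'))

theorem exists_active_of_mem_visited {k : ℕ} {v : Fin (n + 1)}
    (h : v ∈ (searchState B k).visited) :
    ∃ j < n + 1, ∃ rest, (searchState B j).pending = v :: rest := by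
  obtain ⟨j, hj, hv⟩ := exists_pending_of_mem_visited h
  have hj' : j < n + 1 := lt_of_pending hB (by rintro h; simp [h] at hv)
  obtain ⟨l, h1, h2, h3⟩ := exists_active_of_pending hj'.le hv (by simp [pending_eq_nil hB le_rfl])
  exact ⟨l, h2, h3⟩

/-- A node is active only once, so an arc from `v` to `w` arises at this very step. An arc from `w`
to `v` is impossible: it requires `w` visited and `v` unvisited at the time when `w` is active,
whereas here `v` is visited and `w` is not. -/
theorem mem_block_iff {k : ℕ} {v w : Fin (n + 1)} {rest : List (Fin (n + 1))}
    (hp : (searchState B k).pending = v :: rest) :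
    w ∈ B (searchState B k).visited v ↔
      (SimpleGraph.fromRel (fun v w => (v, w) ∈ (searchState B (n + 1)).arcs)).Adj v w ∧
        w ∉ (searchState B k).visited := by
  have hk : k < n + 1 := lt_of_pending hB (by simp [hp])
  have hv : v ∈ (searchState B k).visited := pending_subset_visited k (by simp [hp])
  constructor
  · intro hw
    have hw' := (hB k v rest hp).2 w hw
    refine ⟨⟨?_, Or.inl ((arcs_prefix hk).subset (mem_arcs_succ hp hw))⟩, hw'⟩
    rintro rfl
    exact hw' hv
  · rintro ⟨⟨hne, h | h⟩, hw⟩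
    · obtain ⟨l, hl, r, hl', hwl⟩ := exists_of_mem_arcs h
      obtain rfl := active_unique hB hp hl'
      exact hwl
    · exfalso
      obtain ⟨l, hl, r, hl', hwl⟩ := exists_of_mem_arcs h
      have hvl := (hB l w r hl').2 v hwl
      have hwl : w ∈ (searchState B l).visited := pending_subset_visited l (by simp [hl'])
      rcases le_total l k with hlk | hlk
      · exact hw ((visited_prefix hlk).subset hwl)
      · exact hvl ((visited_prefix hlk).subset hv)

end Search

/-! ### Search trees, and the search repeated on its own tree. -/

theorem searchState_congr {B B' : List (Fin (n + 1)) → Fin (n + 1) → List (Fin (n + 1))}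
    (h : ∀ k v rest, (searchState B k).pending = v :: rest →
      B' (searchState B k).visited v = B (searchState B k).visited v) (k : ℕ) :
    searchState B' k = searchState B k := by
  induction k with
  | zero => rfl
  | succ k ih =>
    rcases hp : (searchState B k).pending with _ | ⟨v, rest⟩
    · rw [searchState_succ_of_nil hp, searchState_succ_of_nil (by rw [ih, hp]), ih]
    · rw [searchState_succ_of_cons hp, searchState_succ_of_cons (by rw [ih, hp]), ih, h k v rest hp]

/-- The neighbors-first search of the graph formed by the arcs of a search is that search. -/
theorem searchState_newNeighbors_fromRel
    {B : List (Fin (n + 1)) → Fin (n + 1) → List (Fin (n + 1))} (hB : Admissible B) (k : ℕ) :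
    searchState (newNeighbors
      (SimpleGraph.fromRel (fun v w => (v, w) ∈ (searchState B (n + 1)).arcs))) k =
      searchState B k :=
  searchState_congr (fun k v rest hp => newNeighbors_eq_of_forall_mem_iff (hB k v rest hp).1
    (fun _ => mem_block_iff hB hp)) k

theorem searchTree_eq (G : SimpleGraph (Fin (n + 1))) :
    searchTree G =
      SimpleGraph.fromRel (fun v w => (v, w) ∈ (searchState (newNeighbors G) (n + 1)).arcs) := by
  rw [searchTree, nfs_eq_searchState]

theorem adj_of_mem_arcs {G : SimpleGraph (Fin (n + 1))} {k : ℕ} {v w : Fin (n + 1)}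
    (h : (v, w) ∈ (searchState (newNeighbors G) k).arcs) : G.Adj v w := by
  obtain ⟨l, _, r, _, hw⟩ := exists_of_mem_arcs h
  exact ((mem_newNeighbors G _ _ _).1 hw).1

theorem searchTree_le (G : SimpleGraph (Fin (n + 1))) : searchTree G ≤ G := by
  rw [searchTree_eq]
  rintro v w ⟨_, h | h⟩
  · exact adj_of_mem_arcs h
  · exact (adj_of_mem_arcs h).symm

/-- Induction along a walk towards the root: the next node on the walk is visited, hence active at
some time, and by the end of that step all its neighbors have been visited. -/
theorem mem_visited_of_connected {G : SimpleGraph (Fin (n + 1))} (hG : G.Connected)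
    (v : Fin (n + 1)) : v ∈ (searchState (newNeighbors G) (n + 1)).visited := by
  obtain ⟨p⟩ := hG.preconnected v (Fin.last n)
  generalize hx : Fin.last n = x at p
  induction p with
  | nil => exact hx ▸ last_mem_visited _
  | @cons u w x hadj p ih =>
    specialize ih hx
    obtain ⟨j, hj, r, hp⟩ := exists_active_of_mem_visited (admissible_newNeighbors G) ih
    by_cases hu : u ∈ (searchState (newNeighbors G) j).visited
    · exact (visited_prefix hj.le).subset hu
    · refine (visited_prefix (Nat.succ_le_of_lt hj)).subset ?_
      rw [Nat.succ_eq_add_one, searchState_succ_of_cons hp, List.mem_append]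
      exact Or.inr ((mem_newNeighbors G _ _ _).2 ⟨hadj.symm, hu⟩)

theorem length_eq_of_forall_mem {l : List (Fin (n + 1))} (hl : l.Nodup) (h : ∀ v, v ∈ l) :
    l.length = n + 1 := by
  have h1 := List.toFinset_card_of_nodup hl
  have h2 : l.toFinset = Finset.univ := by ext v; simp [h]
  rw [← h1, h2, Finset.card_univ, Fintype.card_fin]

/-- Every node other than the root is the end of exactly one arc, so there are `n` arcs and at most
`n` edges; a connected graph with so few edges is a tree. -/
theorem isTree_fromRel_arcs {B : List (Fin (n + 1)) → Fin (n + 1) → List (Fin (n + 1))}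
    (hB : Admissible B) (h : ∀ v, v ∈ (searchState B (n + 1)).visited) :
    (SimpleGraph.fromRel (fun v w => (v, w) ∈ (searchState B (n + 1)).arcs)).IsTree := by
  set A := (searchState B (n + 1)).arcs with hA
  set T := SimpleGraph.fromRel (fun v w => (v, w) ∈ A) with hT
  have hconn : T.Connected := by
    rw [SimpleGraph.connected_iff_exists_forall_reachable]
    refine ⟨Fin.last n, fun v => reachable_of_mem_visited (fun v w hvw => ?_) (h v)⟩
    refine ⟨?_, Or.inl hvw⟩
    rintro rfl
    obtain ⟨l, _, r, hp, hw⟩ := exists_of_mem_arcs hvw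
    exact (hB _ _ _ hp).2 _ hw (pending_subset_visited l (by simp [hp]))
  rw [SimpleGraph.isTree_iff_connected_and_card]
  refine ⟨hconn, le_antisymm ?_ hconn.card_vert_le_card_edgeSet_add_one⟩
  have hlen := length_eq_of_forall_mem (visited_nodup hB (n + 1)) h
  rw [visited_eq, List.length_cons, List.length_map, ← hA] at hlen
  have hsub : T.edgeSet ⊆ ((A.map (fun p => s(p.1, p.2))).toFinset : Set (Sym2 (Fin (n + 1)))) := by
    intro e
    induction e with
    | h a b =>
      rintro ⟨_, h | h⟩
      · simp only [List.coe_toFinset, List.mem_map, Set.mem_ofPred_eq]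
        exact ⟨_, h, rfl⟩
      · simp only [List.coe_toFinset, List.mem_map, Set.mem_ofPred_eq]
        exact ⟨_, h, Sym2.eq_swap⟩
  have h1 := Set.ncard_le_ncard hsub (Finset.finite_toSet _)
  rw [Set.ncard_coe_finset] at h1
  have h2 := h1.trans (List.toFinset_card_le _)
  rw [List.length_map] at h2
  rw [Nat.card_coe_set_eq, Nat.card_eq_fintype_card, Fintype.card_fin]
  omega

theorem isTree_searchTree {G : SimpleGraph (Fin (n + 1))} (hG : G.Connected) :
    (searchTree G).IsTree := by
  rw [searchTree_eq]
  exact isTree_fromRel_arcs (admissible_newNeighbors G) (mem_visited_of_connected hG)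

theorem searchTree_of_isTree {T : SimpleGraph (Fin (n + 1))} (hT : T.IsTree) :
    searchTree T = T :=
  le_antisymm (searchTree_le T)
    ((SimpleGraph.isTree_iff_minimal_connected.1 hT).2
      (isTree_searchTree hT.connected).connected (searchTree_le T))

theorem searchState_searchTree (G : SimpleGraph (Fin (n + 1))) (k : ℕ) :
    searchState (newNeighbors (searchTree G)) k = searchState (newNeighbors G) k := by
  rw [searchTree_eq, searchState_newNeighbors_fromRel (admissible_newNeighbors G)]

/-! ### Parents, cane paths and the stack of the search of a tree. -/

theorem IsParent.unique {T : SimpleGraph (Fin (n + 1))} (hT : T.IsTree) {u u' v : Fin (n + 1)}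
    (h : IsParent T u v) (h' : IsParent T u' v) : u = u' := by
  obtain ⟨p, hp, hlen⟩ := hT.connected.exists_path_of_dist (Fin.last n) v
  have key : ∀ x, IsParent T x v → x = p.penultimate := by
    intro x hx
    obtain ⟨q, hq, hql⟩ := hT.connected.exists_path_of_dist (Fin.last n) x
    have hc : (q.concat hx.1).IsPath := by
      apply SimpleGraph.Walk.isPath_of_length_eq_dist
      rw [SimpleGraph.Walk.length_concat, hql, hx.2]
    have hsub := hT.isAcyclic.subsingleton_path (Fin.last n) v
    have : q.concat hx.1 = p :=
      congrArg Subtype.val (hsub.elim (⟨_, hc⟩ : T.Path _ _) ⟨p, hp⟩)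
    rw [← this]
    simp
  rw [key u h, key u' h']

theorem not_isParent_last {T : SimpleGraph (Fin (n + 1))} (u : Fin (n + 1)) :
    ¬ IsParent T u (Fin.last n) := by
  rintro ⟨_, h⟩
  simp at h

section Tree

variable {T : SimpleGraph (Fin (n + 1))} (hT : T.IsTree)
include hT

theorem isParent_of_mem_arcs {k : ℕ} {v w : Fin (n + 1)}
    (h : (v, w) ∈ (searchState (newNeighbors T) k).arcs) : IsParent T v w := by
  induction k generalizing v w with
  | zero => simp at h
  | succ k ih =>
    rcases hp : (searchState (newNeighbors T) k).pending with _ | ⟨u, rest⟩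
    · rw [searchState_succ_of_nil hp] at h; exact ih h
    · rw [searchState_succ_of_cons hp] at h
      simp only [List.mem_append, List.mem_map, Prod.mk.injEq] at h
      rcases h with h | ⟨x, hx, rfl, rfl⟩
      · exact ih h
      · obtain ⟨hadj, hnv⟩ := (mem_newNeighbors T _ _ _).1 hx
        refine ⟨hadj, ?_⟩
        -- If `x` were the parent of `u`, then `u` would have been visited along an arc from `x`, by
        -- induction and uniqueness of parents, so `x` would already be visited.
        rcases hT.dist_eq_dist_add_one_of_adj (Fin.last n) hadj with h | h
        · exfalso
          have hu : u ∈ (searchState (newNeighbors T) k).visited :=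
            pending_subset_visited k (by simp [hp])
          rw [visited_eq] at hu
          rcases List.mem_cons.1 hu with rfl | hu
          · simp at h
          · obtain ⟨⟨y, z⟩, hy, rfl⟩ := List.mem_map.1 hu
            have hyx : y = x := (ih hy).unique hT ⟨hadj.symm, h⟩
            subst hyx
            obtain ⟨l, hl, r, hl', _⟩ := exists_of_mem_arcs hy
            exact hnv ((visited_prefix hl.le).subset (pending_subset_visited l (by simp [hl'])))
        · exact h

theorem mem_newNeighbors_iff_isParent {k : ℕ} {v w : Fin (n + 1)} {rest : List (Fin (n + 1))}
    (hp : (searchState (newNeighbors T) k).pending = v :: rest) :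
    w ∈ newNeighbors T (searchState (newNeighbors T) k).visited v ↔ IsParent T v w := by
  constructor
  · intro h
    exact isParent_of_mem_arcs hT (mem_arcs_succ hp h)
  · intro h
    refine (mem_newNeighbors T _ _ _).2 ⟨h.1, fun hw => ?_⟩
    rw [visited_eq] at hw
    rcases List.mem_cons.1 hw with rfl | hw
    · exact not_isParent_last _ h
    · obtain ⟨⟨y, z⟩, hy, rfl⟩ := List.mem_map.1 hw
      obtain rfl := (isParent_of_mem_arcs hT hy).unique hT h
      obtain ⟨l, hl, r, hl', _⟩ := exists_of_mem_arcs hy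
      exact hl.ne (active_unique (admissible_newNeighbors T) hl' hp)

end Tree

theorem not_isCanePath_pair {T : SimpleGraph (Fin (n + 1))} (b c : Fin (n + 1)) :
    ¬ IsCanePath T [b, c] := by
  intro h
  cases h with
  | up _ h => cases h

section Tree

variable {T : SimpleGraph (Fin (n + 1))}

theorem canePaths_last : {p | IsCanePath T p ∧ p.head? = some (Fin.last n)} = ∅ := by
  ext p
  simp only [Set.mem_ofPred_eq, Set.mem_empty_iff_false, iff_false, not_and]
  intro h hp
  cases h with
  | base hup _ _ =>
    obtain rfl := Option.some.inj hp
    exact not_isParent_last _ hup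
  | up hup _ =>
    obtain rfl := Option.some.inj hp
    exact not_isParent_last _ hup

theorem canePaths_eq (hT : T.IsTree) {a b : Fin (n + 1)} (hab : IsParent T b a) :
    {p | IsCanePath T p ∧ p.head? = some a} =
      (fun q => a :: q) '' {p | IsCanePath T p ∧ p.head? = some b} ∪
        (fun c => [a, b, c]) '' {c | IsParent T b c ∧ a < c} := by
  ext p
  constructor
  · rintro ⟨h, hp⟩
    cases h with
    | base hup hdown hright =>
      obtain rfl := Option.some.inj hp
      obtain rfl := hup.unique hT hab
      exact Or.inr ⟨_, ⟨hdown, hright⟩, rfl⟩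
    | up hup h =>
      obtain rfl := Option.some.inj hp
      obtain rfl := hup.unique hT hab
      exact Or.inl ⟨_, ⟨h, rfl⟩, rfl⟩
  · rintro (⟨q, ⟨hq, hqb⟩, rfl⟩ | ⟨c, ⟨hc, hac⟩, rfl⟩)
    · cases q with
      | nil => simp at hqb
      | cons x l =>
        obtain rfl := Option.some.inj hqb
        exact ⟨IsCanePath.up hab hq, rfl⟩
    · exact ⟨IsCanePath.base hab hc hac, rfl⟩

/-- A cane path from `a` begins with the step up to `b` and either continues as a cane path from `b`
or turns down at once. Extended cardinalities make this additive before finiteness is known;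
finiteness then comes out of the count along the stack. -/
theorem encard_canePaths (hT : T.IsTree) {a b : Fin (n + 1)} (hab : IsParent T b a) :
    {p | IsCanePath T p ∧ p.head? = some a}.encard =
      {p | IsCanePath T p ∧ p.head? = some b}.encard + {c | IsParent T b c ∧ a < c}.encard := by
  rw [canePaths_eq hT hab, Set.encard_union_eq, Function.Injective.encard_image,
    Function.Injective.encard_image]
  · intro c c' h
    simpa using h
  · intro c c' h
    simpa using h
  · rw [Set.disjoint_left]
    rintro _ ⟨q, ⟨hq, _⟩, rfl⟩ ⟨c, _, h⟩
    obtain rfl : [b, c] = q := by simpa using h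
    exact not_isCanePath_pair _ _ hq

/-- In a list of nodes waiting to become active, the number of cane paths starting in a node is the
number of nodes below it. -/
theorem encard_canePaths_of_suffix (hT : T.IsTree) (k : ℕ) {v : Fin (n + 1)}
    {r : List (Fin (n + 1))} (h : v :: r <:+ (searchState (newNeighbors T) k).pending) :
    {p | IsCanePath T p ∧ p.head? = some v}.encard = r.length := by
  induction k generalizing v r with
  | zero =>
    obtain ⟨X, hX⟩ := h
    rw [searchState_zero, List.append_eq_singleton_iff] at hX
    rcases hX with ⟨_, h⟩ | ⟨_, h⟩
    · obtain ⟨rfl, rfl⟩ := List.cons.inj h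
      rw [canePaths_last]; simp
    · cases h
  | succ k ih =>
    rcases hp : (searchState (newNeighbors T) k).pending with _ | ⟨u, rest⟩
    · rw [searchState_succ_of_nil hp] at h
      exact ih h
    · have hu := ih (v := u) (r := rest) (by rw [hp])
      have hmem := fun w => mem_newNeighbors_iff_isParent hT (w := w) hp
      have hpw := newNeighbors_pairwise T (searchState (newNeighbors T) k).visited u
      rw [searchState_succ_of_cons hp] at h
      set B := newNeighbors T (searchState (newNeighbors T) k).visited u
      obtain ⟨X, hX⟩ := h
      replace hX : X ++ v :: r = B.reverse ++ rest := hX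
      have hrest : v :: r <:+ rest →
          {p | IsCanePath T p ∧ p.head? = some v}.encard = r.length := fun h =>
        ih (by rw [hp]; exact h.trans (List.suffix_cons u rest))
      -- Either `v` lies in `rest`, where induction applies, or `v` is in the new block. In the
      -- latter case `r = Y ++ rest`, where `Y` consists of the siblings larger than `v`, and `rest`
      -- accounts for the cane paths of the parent `u`.
      rcases List.append_eq_append_iff.1 hX with ⟨Y, hY, hr⟩ | ⟨Y, hY, hr⟩
      · rcases Y with _ | ⟨y, Y⟩
        · exact hrest (by rw [hr]; simp)
        · obtain ⟨rfl, rfl⟩ := List.cons.inj hr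
          have hB : B = Y.reverse ++ v :: X.reverse := by
            rw [← List.reverse_reverse B, hY]; simp
          have hset : {c | IsParent T u c ∧ v < c} = {c | c ∈ Y} := by
            rw [hB, List.pairwise_append, List.pairwise_cons] at hpw
            obtain ⟨_, ⟨h1, _⟩, h3⟩ := hpw
            ext c
            simp only [Set.mem_ofPred_eq, ← hmem, hB, List.mem_append, List.mem_reverse,
              List.mem_cons]
            constructor
            · rintro ⟨hc | rfl | hc, hlt⟩
              · exact hc
              · exact absurd hlt (lt_irrefl _)
              · exact absurd hlt (lt_asymm (h1 c (List.mem_reverse.2 hc)))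
            · intro hc
              exact ⟨Or.inl hc, h3 c (List.mem_reverse.2 hc) v (by simp)⟩
          have hYnd : Y.Nodup := by
            have : B.Nodup := hpw.imp (fun h => ne_of_gt h)
            rw [hB] at this
            exact List.nodup_reverse.1 this.of_append_left
          have hv : IsParent T u v := (hmem v).1 (by rw [hB]; simp)
          rw [encard_canePaths hT hv, hset, hu]
          have : {c | c ∈ Y} = ((Y.toFinset : Finset _) : Set (Fin (n + 1))) := by
            ext; simp
          rw [this, Set.encard_coe_eq_coe_finsetCard, List.toFinset_card_of_nodup hYnd,
            List.append_eq, List.length_append, Nat.cast_add, add_comm]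
      · exact hrest (by rw [hr]; exact List.suffix_append _ _)

theorem caneCount_of_suffix (hT : T.IsTree) {k : ℕ} {v : Fin (n + 1)}
    {r : List (Fin (n + 1))} (h : v :: r <:+ (searchState (newNeighbors T) k).pending) :
    caneCount T v = r.length := by
  rw [caneCount, Set.ncard_def, encard_canePaths_of_suffix hT k h]
  simp

theorem caneCount_of_pending (hT : T.IsTree) {k : ℕ} {v : Fin (n + 1)}
    {r : List (Fin (n + 1))} (h : (searchState (newNeighbors T) k).pending = v :: r) :
    caneCount T v = r.length :=
  caneCount_of_suffix hT (k := k) (by rw [h])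

theorem caneCount_last (hT : T.IsTree) : caneCount T (Fin.last n) = 0 :=
  caneCount_of_pending hT (k := 0) (r := []) rfl

end Tree

/-! ### The connected graphs with a given search tree. -/

/-- While `v` is active, `w` has been visited but not yet been active. -/
def WaitsFor (T : SimpleGraph (Fin (n + 1))) (v w : Fin (n + 1)) : Prop :=
  ∃ k rest, (searchState (newNeighbors T) k).pending = v :: rest ∧ w ∈ rest

section

variable {T : SimpleGraph (Fin (n + 1))}

/-- If `w` waits for `v`, then `v` is the first of the two nodes to become active. -/
theorem WaitsFor.lt {v w : Fin (n + 1)} (h : WaitsFor T v w) {i j : ℕ}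
    {r r' : List (Fin (n + 1))} (hi : (searchState (newNeighbors T) i).pending = v :: r)
    (hj : (searchState (newNeighbors T) j).pending = w :: r') : i < j := by
  obtain ⟨k, s, hk, hw⟩ := h
  have hadm := admissible_newNeighbors T
  obtain rfl := active_unique hadm hi hk
  by_contra hij
  rcases (not_lt.1 hij).lt_or_eq with hij | rfl
  · exact not_mem_pending_of_active hadm hij hj (by simp [hk, hw])
  · rw [hk] at hj
    obtain ⟨rfl, rfl⟩ := List.cons.inj hj
    have := pending_nodup hadm j
    rw [hk] at this
    exact (List.nodup_cons.1 this).1 hw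

/-- The searches of `G` and `T` coincide. When `v`, the earlier of the two nodes, is active, `w` is
either unvisited, so that the edge puts it into the block of `v`, or visited and still pending,
because it becomes active later. -/
theorem waitsFor_of_adj {G : SimpleGraph (Fin (n + 1))} (hG : searchTree G = T) {v w : Fin (n + 1)}
    (hadj : G.Adj v w) {i j : ℕ} {r r' : List (Fin (n + 1))}
    (hi : (searchState (newNeighbors T) i).pending = v :: r)
    (hj : (searchState (newNeighbors T) j).pending = w :: r') (hij : i < j) :
    T.Adj v w ∨ WaitsFor T v w := by
  have hrun : ∀ k, searchState (newNeighbors T) k = searchState (newNeighbors G) k := by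
    intro k; rw [← hG, searchState_searchTree]
  have hadm := admissible_newNeighbors T
  by_cases hw : w ∈ (searchState (newNeighbors T) i).visited
  · right
    refine ⟨i, r, hi, ?_⟩
    by_contra hwr
    refine not_mem_pending_of_le hadm hij.le hw ?_ (by rw [hj]; simp)
    rw [hi, List.mem_cons, not_or]
    refine ⟨?_, hwr⟩
    rintro rfl
    exact hadj.ne rfl
  · left
    rw [hrun] at hi hw
    have hblock := (mem_newNeighbors G _ _ _).2 ⟨hadj, hw⟩
    have := mem_arcs_succ hi hblock
    rw [← hrun] at this
    exact adj_of_mem_arcs this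

variable (hT : T.IsTree)
include hT

theorem exists_active (v : Fin (n + 1)) :
    ∃ k rest, (searchState (newNeighbors T) k).pending = v :: rest := by
  obtain ⟨j, _, h⟩ := exists_active_of_mem_visited (admissible_newNeighbors T)
    (mem_visited_of_connected hT.connected v)
  exact ⟨j, h⟩

theorem WaitsFor.asymm {v w : Fin (n + 1)} (h : WaitsFor T v w) (h' : WaitsFor T w v) : False := by
  obtain ⟨i, r, hi⟩ := exists_active hT v
  obtain ⟨j, s, hj⟩ := exists_active hT w
  exact lt_asymm (h.lt hi hj) (h'.lt hj hi)

theorem WaitsFor.not_adj {v w : Fin (n + 1)} (h : WaitsFor T v w) : ¬ T.Adj v w := by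
  intro hadj
  have hadm := admissible_newNeighbors T
  rw [← searchTree_of_isTree hT, searchTree_eq] at hadj
  obtain ⟨hne, ha | ha⟩ := hadj
  · obtain ⟨l, _, r, hp, hw⟩ := exists_of_mem_arcs ha
    obtain ⟨k, s, hk, hws⟩ := h
    obtain rfl := active_unique hadm hp hk
    exact (hadm _ _ _ hp).2 _ hw (pending_subset_visited l (by simp [hk, hws]))
  · obtain ⟨l, _, r, hp, hv⟩ := exists_of_mem_arcs ha
    obtain ⟨k, s, hk, hws⟩ := id h
    have hlt := h.lt hk hp
    exact (hadm _ _ _ hp).2 _ hv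
      ((visited_prefix hlt.le).subset (pending_subset_visited k (by simp [hk])))

/-- The optional edges. Each `v` contributes as many as there are nodes below it in the stack, that
is `caneCount T v`; by asymmetry of waiting no unordered pair is counted twice. -/
theorem exists_card_eq_alpha :
    ∃ A : Finset (Sym2 (Fin (n + 1))), A.card = alpha T ∧
      ∀ v w, s(v, w) ∈ A ↔ WaitsFor T v w ∨ WaitsFor T w v := by
  classical
  choose time below hbelow using exists_active hT
  have hmem : ∀ v w, w ∈ below v ↔ WaitsFor T v w := by
    intro v w
    constructor
    · intro h; exact ⟨_, _, hbelow v, h⟩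
    · rintro ⟨k, r, hk, hw⟩
      obtain rfl := active_unique (admissible_newNeighbors T) (hbelow v) hk
      rw [hbelow v] at hk
      rwa [(List.cons.inj hk).2]
  have hnd : ∀ v, (below v).Nodup := by
    intro v
    have := pending_nodup (admissible_newNeighbors T) (time v)
    rw [hbelow v] at this
    exact (List.nodup_cons.1 this).2
  refine ⟨(Finset.univ.sigma (fun v => (below v).toFinset)).image (fun p => s(p.1, p.2)), ?_, ?_⟩
  · rw [Finset.card_image_of_injOn, Finset.card_sigma, alpha]
    · refine Finset.sum_congr rfl (fun v _ => ?_)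
      rw [List.toFinset_card_of_nodup (hnd v), caneCount_of_pending hT (hbelow v)]
    · rintro ⟨a, b⟩ hab ⟨c, d⟩ hcd h
      simp only [Finset.coe_sigma, Set.mem_sigma_iff, Finset.mem_coe, List.mem_toFinset, hmem] at hab hcd
      simp only [Sym2.eq_iff] at h
      rcases h with ⟨rfl, rfl⟩ | ⟨rfl, rfl⟩
      · rfl
      · exact (WaitsFor.asymm hT hab.2 hcd.2).elim
  · intro v w
    simp only [Finset.mem_image, Finset.mem_sigma, Finset.mem_univ, true_and, List.mem_toFinset,
      hmem, Sigma.exists, Sym2.eq_iff]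
    constructor
    · rintro ⟨a, b, h, ⟨rfl, rfl⟩ | ⟨rfl, rfl⟩⟩
      · exact Or.inl h
      · exact Or.inr h
    · rintro (h | h)
      · exact ⟨v, w, h, Or.inl ⟨rfl, rfl⟩⟩
      · exact ⟨w, v, h, Or.inr ⟨rfl, rfl⟩⟩

/-- For the converse, an optional edge never joins an active node to an unvisited one, so adding
such edges to `T` leaves every block of the search unchanged. -/
theorem searchTree_eq_iff (G : SimpleGraph (Fin (n + 1))) :
    (G.Connected ∧ searchTree G = T) ↔
      T ≤ G ∧ ∀ v w, G.Adj v w → T.Adj v w ∨ WaitsFor T v w ∨ WaitsFor T w v := by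
  have hadm := admissible_newNeighbors T
  constructor
  · rintro ⟨_, hG⟩
    refine ⟨hG ▸ searchTree_le G, fun v w hadj => ?_⟩
    obtain ⟨i, r, hi⟩ := exists_active hT v
    obtain ⟨j, s, hj⟩ := exists_active hT w
    rcases lt_trichotomy i j with hij | rfl | hij
    · rcases waitsFor_of_adj hG hadj hi hj hij with h | h
      · exact Or.inl h
      · exact Or.inr (Or.inl h)
    · rw [hi] at hj
      exact absurd (List.cons.inj hj).1 hadj.ne
    · rcases waitsFor_of_adj hG hadj.symm hj hi hij with h | h
      · exact Or.inl h.symm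
      · exact Or.inr (Or.inr h)
  · rintro ⟨hle, h⟩
    refine ⟨hT.connected.mono hle, ?_⟩
    have hrun : ∀ k, searchState (newNeighbors G) k = searchState (newNeighbors T) k := by
      refine searchState_congr (fun k v rest hp => ?_)
      refine newNeighbors_eq_of_forall_mem_iff (newNeighbors_pairwise _ _ _) (fun w => ?_)
      rw [mem_newNeighbors]
      refine ⟨fun hw => ⟨hle hw.1, hw.2⟩, fun hw => ⟨?_, hw.2⟩⟩
      rcases h v w hw.1 with hvw | hvw | hvw
      · exact hvw
      · obtain ⟨j, r, hj, hwr⟩ := hvw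
        obtain rfl := active_unique hadm hp hj
        exact absurd (pending_subset_visited k (by simp [hj, hwr])) hw.2
      · obtain ⟨j, r, hj, hvr⟩ := id hvw
        have hlt := hvw.lt hj hp
        exact absurd ((visited_prefix hlt.le).subset (pending_subset_visited j (by simp [hj]))) hw.2
    rw [searchTree_eq, hrun, ← searchTree_eq, searchTree_of_isTree hT]

theorem connectedEdgeSum_fiber (t : ℝ) :
    connectedEdgeSum n t (fun G => searchTree G = T) = t ^ n * (1 + t) ^ alpha T := by
  classical
  obtain ⟨A, hA, hmem⟩ := exists_card_eq_alpha hT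
  have hcardT : T.edgeSet.ncard = n := by
    have := (SimpleGraph.isTree_iff_connected_and_card.1 hT).2
    rw [Nat.card_coe_set_eq, Nat.card_eq_fintype_card, Fintype.card_fin] at this
    omega
  have hwne : ∀ {v w}, WaitsFor T v w → v ≠ w := by
    rintro v w h rfl
    exact h.asymm hT h
  have hdisj : Disjoint T.edgeSet (A : Set (Sym2 (Fin (n + 1)))) := by
    rw [Set.disjoint_left]
    intro e
    induction e with
    | h a b =>
      intro h1 h2
      rcases (hmem a b).1 h2 with h | h
      · exact h.not_adj hT h1
      · exact h.not_adj hT h1.symm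
  have hedge : ∀ S ⊆ A, (T ⊔ SimpleGraph.fromEdgeSet (S : Set _)).edgeSet = T.edgeSet ∪ S := by
    intro S hS
    rw [SimpleGraph.edgeSet_sup, SimpleGraph.edgeSet_fromEdgeSet, Disjoint.sdiff_eq_left]
    rw [Set.disjoint_left]
    intro e
    induction e with
    | h a b =>
      intro h1 h2
      have hab : a = b := by simpa using h2
      rcases (hmem a b).1 (hS h1) with h | h
      · exact hwne h hab
      · exact hwne h hab.symm
  calc connectedEdgeSum n t (fun G => searchTree G = T)
      -- `G` corresponds to the set of its optional edges. The factor `1 ^ _` brings the sum into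
      -- the shape of the binomial theorem.
      = ∑ S ∈ A.powerset, t ^ n * (t ^ S.card * 1 ^ (A.card - S.card)) := by
        rw [connectedEdgeSum]
        refine Finset.sum_nbij' (fun G => (Set.toFinite (G.edgeSet ∩ (A : Set _))).toFinset)
          (fun S => T ⊔ SimpleGraph.fromEdgeSet (S : Set _)) ?_ ?_ ?_ ?_ ?_
        · intro G _
          rw [Finset.mem_powerset]
          intro e he
          exact ((Set.Finite.mem_toFinset _).1 he).2
        · intro S hS
          simp only [Finset.mem_filter, Finset.mem_univ, true_and]
          rw [searchTree_eq_iff hT]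
          refine ⟨le_sup_left, ?_⟩
          rintro v w (h | h)
          · exact Or.inl h
          · exact Or.inr ((hmem v w).1 (Finset.mem_powerset.1 hS h.1))
        · intro G hG
          simp only [Finset.mem_filter, Finset.mem_univ, true_and] at hG
          rw [searchTree_eq_iff hT] at hG
          apply SimpleGraph.edgeSet_injective
          rw [hedge _ (fun e he => ((Set.Finite.mem_toFinset _).1 he).2), Set.Finite.coe_toFinset]
          ext e
          simp only [Set.mem_union, Set.mem_inter_iff, Finset.mem_coe]
          constructor
          · rintro (h | h)
            · exact SimpleGraph.edgeSet_mono hG.1 h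
            · exact h.1
          · induction e with
            | h a b =>
              intro h
              rcases hG.2 a b h with h' | h'
              · exact Or.inl h'
              · exact Or.inr ⟨h, (hmem a b).2 h'⟩
        · intro S hS
          have hS := Finset.mem_powerset.1 hS
          ext e
          rw [Set.Finite.mem_toFinset, hedge S hS]
          constructor
          · rintro ⟨h2 | h2, h1⟩
            · exact absurd h1 (Set.disjoint_left.1 hdisj h2)
            · exact h2
          · intro h
            exact ⟨Or.inr h, hS h⟩
        · intro G hG
          simp only [Finset.mem_filter, Finset.mem_univ, true_and] at hG
          rw [searchTree_eq_iff hT] at hG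
          rw [one_pow, mul_one, ← pow_add]
          congr 1
          have : G.edgeSet = T.edgeSet ∪ (G.edgeSet ∩ A) := by
            ext e
            simp only [Set.mem_union, Set.mem_inter_iff, Finset.mem_coe]
            constructor
            · induction e with
              | h a b =>
                intro h
                rcases hG.2 a b h with h' | h'
                · exact Or.inl h'
                · exact Or.inr ⟨h, (hmem a b).2 h'⟩
            · rintro (h | h)
              · exact SimpleGraph.edgeSet_mono hG.1 h
              · exact h.1
          have hcard := Set.ncard_union_eq
            (hdisj.mono_right (Set.inter_subset_right (s := G.edgeSet)))
          rw [← this, hcardT] at hcard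
          rw [← Set.ncard_eq_toFinset_card, hcard]
    _ = t ^ n * (1 + t) ^ alpha T := by
        rw [← Finset.mul_sum, Finset.sum_pow_mul_eq_add_pow, hA, add_comm t 1]

end

/-- Connected graphs are classified by their search trees. -/
theorem connectedEdgeSum_eq_sum [Fintype {T : SimpleGraph (Fin (n + 1)) // T.IsTree}] (t : ℝ) :
    connectedEdgeSum n t (fun _ => True) =
      ∑ T : {T : SimpleGraph (Fin (n + 1)) // T.IsTree},
        connectedEdgeSum n t (fun G => searchTree G = T.1) := by
  classical
  simp only [connectedEdgeSum, and_true, Finset.sum_filter]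
  rw [Finset.sum_comm]
  refine Finset.sum_congr rfl (fun G _ => ?_)
  by_cases hG : G.Connected
  · rw [Finset.sum_eq_single ⟨searchTree G, isTree_searchTree hG⟩]
    · simp [hG]
    · intro T _ hT
      rw [if_neg]
      rintro ⟨_, h⟩
      exact hT (Subtype.ext h.symm)
    · simp
  · simp [hG]

/-! ### Coding a tree by its visiting order and its cane counts. -/

/-- The values of `m` along the list are `r, r + 1, …`. -/
def Graded {α : Type*} (m : α → ℕ) : ℕ → List α → Prop
  | _, [] => True
  | r, a :: l => m a = r ∧ Graded m (r + 1) l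

/-- The longest prefix of a list along which the values of `m` are `r, r + 1, …`. -/
def gradedPrefix {α : Type*} (m : α → ℕ) : ℕ → List α → List α
  | _, [] => []
  | r, a :: l => if m a = r then a :: gradedPrefix m (r + 1) l else []

section Graded

variable {α : Type*} {m : α → ℕ}

theorem graded_append {r : ℕ} {l l' : List α} :
    Graded m r (l ++ l') ↔ Graded m r l ∧ Graded m (r + l.length) l' := by
  induction l generalizing r with
  | nil => simp [Graded]
  | cons a l ih =>
    simp only [List.cons_append, Graded, ih, List.length_cons, and_assoc]
    rw [show r + 1 + l.length = r + (l.length + 1) by omega]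

theorem graded_of_forall {r : ℕ} {l : List α}
    (h : ∀ X a Y, l = X ++ a :: Y → m a = r + X.length) : Graded m r l := by
  induction l generalizing r with
  | nil => trivial
  | cons a l ih =>
    refine ⟨by simpa using h [] a l rfl, ih (fun X b Y hl => ?_)⟩
    have := h (a :: X) b Y (by rw [hl]; rfl)
    rw [this, List.length_cons]; omega

theorem Graded.head {r : ℕ} {l : List α} (h : Graded m r l) {a : α} (ha : a ∈ l.head?) :
    m a = r := by
  cases l with
  | nil => simp at ha
  | cons b l => obtain rfl : b = a := by simpa using ha
                exact h.1

theorem Graded.getLast {r : ℕ} {l : List α} (h : Graded m r l) {a : α} (ha : a ∈ l.getLast?) :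
    m a + 1 = r + l.length := by
  rcases l.eq_nil_or_concat with rfl | ⟨l, b, rfl⟩
  · simp at ha
  · obtain rfl : b = a := by simpa using ha
    rw [List.concat_eq_append] at h ⊢
    rw [graded_append] at h
    rw [h.2.1, List.length_append, List.length_singleton]
    omega

theorem gradedPrefix_prefix (r : ℕ) (l : List α) : gradedPrefix m r l <+: l := by
  induction l generalizing r with
  | nil => simp [gradedPrefix]
  | cons a l ih =>
    simp only [gradedPrefix]
    split_ifs
    · exact List.cons_prefix_cons.2 ⟨rfl, ih _⟩
    · exact List.nil_prefix

theorem graded_gradedPrefix (r : ℕ) (l : List α) : Graded m r (gradedPrefix m r l) := by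
  induction l generalizing r with
  | nil => trivial
  | cons a l ih =>
    simp only [gradedPrefix]
    split_ifs with h
    · exact ⟨h, ih _⟩
    · trivial

theorem gradedPrefix_append_of_graded {r : ℕ} {l l' : List α} (h : Graded m r l) :
    gradedPrefix m r (l ++ l') = l ++ gradedPrefix m (r + l.length) l' := by
  induction l generalizing r with
  | nil => simp
  | cons a l ih =>
    simp only [List.cons_append, gradedPrefix, h.1, if_true, ih h.2, List.length_cons]
    rw [show r + 1 + l.length = r + (l.length + 1) by omega]

theorem gradedPrefix_eq_nil {r : ℕ} {l : List α} (h : ∀ a ∈ l.head?, m a ≠ r) :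
    gradedPrefix m r l = [] := by
  cases l with
  | nil => rfl
  | cons a l => simp [gradedPrefix, h a (by simp)]

/-- Maximality of the graded prefix: an entry with the next value would have been included. -/
theorem ne_of_mem_head?_of_gradedPrefix_append {r : ℕ} {l l' : List α}
    (h : l = gradedPrefix m r l ++ l') {a : α} (ha : a ∈ l'.head?) :
    m a ≠ r + (gradedPrefix m r l).length := by
  intro hm
  have := gradedPrefix_append_of_graded (l' := l') (graded_gradedPrefix (m := m) r l)
  rw [← h] at this
  have hnil : gradedPrefix m (r + (gradedPrefix m r l).length) l' = [] := by
    simpa using this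
  cases l' with
  | nil => simp at ha
  | cons b l' =>
    obtain rfl : b = a := by simpa using ha
    simp [gradedPrefix, hm] at hnil

end Graded

/-- The relation between consecutive nodes in the order of visits. -/
def StepRel (m : Fin (n + 1) → ℕ) (a b : Fin (n + 1)) : Prop :=
  m b ≤ m a ∨ (m b = m a + 1 ∧ b < a ∧ a ≠ Fin.last n)

theorem StepRel.le {m : Fin (n + 1) → ℕ} {a b : Fin (n + 1)} (h : StepRel m a b) :
    m b ≤ m a + 1 := by
  rcases h with h | h
  · omega
  · exact h.1.le

theorem isChain_stepRel_of_graded {m : Fin (n + 1) → ℕ} {r : ℕ} {l : List (Fin (n + 1))}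
    (h : Graded m r l) (hl : l.Pairwise (· > ·)) (hlast : Fin.last n ∉ l) :
    l.IsChain (StepRel m) := by
  induction l generalizing r with
  | nil => exact List.isChain_nil
  | cons a l ih =>
    rw [List.isChain_cons]
    rw [List.pairwise_cons] at hl
    rw [List.mem_cons, not_or] at hlast
    refine ⟨fun b hb => Or.inr ⟨?_, hl.1 b (List.mem_of_mem_head? hb), Ne.symm hlast.1⟩,
      ih h.2 hl.2 hlast.2⟩
    rw [h.2.head hb, h.1]

/-- Along a graded list `m` rises at every step, which leaves only the alternative of `StepRel` with
a drop of label. -/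
theorem isChain_gt_of_graded {m : Fin (n + 1) → ℕ} {r : ℕ} {l : List (Fin (n + 1))}
    (h : Graded m r l) (hl : l.IsChain (StepRel m)) : l.IsChain (· > ·) := by
  induction l generalizing r with
  | nil => exact List.isChain_nil
  | cons a l ih =>
    rw [List.isChain_cons] at hl ⊢
    refine ⟨fun b hb => ?_, ih h.2 hl.2⟩
    have h1 := h.2.head hb
    have h2 := h.1
    rcases hl.1 b hb with h | h
    · omega
    · exact h.2.1

/-- The search that visits the nodes in the order given by `W`, in blocks determined by `m`. -/
def decodeBlock (W : List (Fin (n + 1))) (m : Fin (n + 1) → ℕ) (l : List (Fin (n + 1)))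
    (v : Fin (n + 1)) : List (Fin (n + 1)) :=
  gradedPrefix m (m v) (W.drop l.length)

section Tree

variable {T : SimpleGraph (Fin (n + 1))} (hT : T.IsTree)
include hT

/-- Read from the bottom of the stack, the cane counts are 0, 1, 2, …, since each is the number of
nodes below. -/
theorem graded_pending (k : ℕ) :
    Graded (caneCount T) 0 (searchState (newNeighbors T) k).pending.reverse := by
  refine graded_of_forall (fun X a Y h => ?_)
  rw [zero_add, caneCount_of_suffix hT (k := k) (r := X.reverse), List.length_reverse]
  refine ⟨Y.reverse, ?_⟩
  rw [← List.reverse_reverse (searchState _ _).pending, h]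
  simp

theorem graded_newNeighbors {k : ℕ} {v : Fin (n + 1)} {rest : List (Fin (n + 1))}
    (hp : (searchState (newNeighbors T) k).pending = v :: rest) :
    Graded (caneCount T) rest.length
      (newNeighbors T (searchState (newNeighbors T) k).visited v) := by
  have := graded_pending hT (k + 1)
  rw [searchState_succ_of_cons hp] at this
  simp only [List.reverse_append, List.reverse_reverse] at this
  have := (graded_append.1 this).2
  rwa [List.length_reverse, zero_add] at this

/-- Inside a block the counts rise by 1 and the labels drop. The bound on the stack says that the
next block, whose first count is the stack size minus 1, starts no higher than the last visited
node. -/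
theorem isChain_visited (k : ℕ) :
    (searchState (newNeighbors T) k).visited.IsChain (StepRel (caneCount T)) ∧
      ∀ a ∈ (searchState (newNeighbors T) k).visited.getLast?,
        (searchState (newNeighbors T) k).pending.length ≤ caneCount T a + 1 := by
  induction k with
  | zero => simp
  | succ k ih =>
    rcases hp : (searchState (newNeighbors T) k).pending with _ | ⟨v, rest⟩
    · rwa [searchState_succ_of_nil hp]
    · have hg := graded_newNeighbors hT hp
      have hlast : Fin.last n ∉ newNeighbors T (searchState (newNeighbors T) k).visited v := by
        rw [mem_newNeighbors]
        exact fun h => h.2 (last_mem_visited k)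
      have hpw := newNeighbors_pairwise T (searchState (newNeighbors T) k).visited v
      rw [searchState_succ_of_cons hp]
      rw [hp] at ih
      simp only [List.length_append, List.length_reverse, List.length_cons] at ih ⊢
      generalize newNeighbors T (searchState (newNeighbors T) k).visited v = B at hg hlast hpw
      refine ⟨List.isChain_append.2 ⟨ih.1, isChain_stepRel_of_graded hg hpw hlast, ?_⟩, ?_⟩
      · intro a ha b hb
        left
        have := ih.2 a ha
        rw [hg.head hb]; omega
      · intro a ha
        rcases B.eq_nil_or_concat with rfl | ⟨B, b, rfl⟩
        · rw [List.append_nil] at ha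
          have := ih.2 a ha
          simp; omega
        · have := hg.getLast (a := a) (by simpa using ha)
          omega

/-- The next node to be visited heads a later block, so its count is the size of the stack left by
the removal of its parent, and the stack only shrinks until then. Hence a block cannot be continued
by the node after it, and the graded prefix recovers exactly the block. -/
theorem caneCount_lt_of_next {d k : ℕ} (hk : k + d = n + 1) {R : List (Fin (n + 1))}
    (hR : (searchState (newNeighbors T) (n + 1)).visited =
      (searchState (newNeighbors T) k).visited ++ R) {y : Fin (n + 1)} (hy : y ∈ R.head?) :
    caneCount T y < (searchState (newNeighbors T) k).pending.length := by
  induction d generalizing k R with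
  | zero =>
    obtain rfl : k = n + 1 := by omega
    obtain rfl : R = [] := by simpa using hR
    simp at hy
  | succ d ih =>
    rcases hp : (searchState (newNeighbors T) k).pending with _ | ⟨v, rest⟩
    · have := ih (k := k + 1) (by omega) (R := R) (by rw [searchState_succ_of_nil hp, hR]) hy
      rwa [searchState_succ_of_nil hp, hp] at this
    · have hg := graded_newNeighbors hT hp
      obtain ⟨R', hR'⟩ := visited_prefix (B := newNeighbors T) (show k + 1 ≤ n + 1 by omega)
      have := ih (k := k + 1) (by omega) (R := R') hR'.symm
      rw [searchState_succ_of_cons hp] at this hR'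
      simp only [List.append_assoc] at hR'
      rw [hR, List.append_cancel_left_eq] at hR'
      generalize newNeighbors T (searchState (newNeighbors T) k).visited v = B at *
      subst hR'
      cases B with
      | nil =>
        have := this hy
        simp at this ⊢
        omega
      | cons b B =>
        obtain rfl : b = y := by simpa using hy
        rw [hg.1]; simp

theorem newNeighbors_eq_decodeBlock {k : ℕ} {v : Fin (n + 1)} {rest : List (Fin (n + 1))}
    (hp : (searchState (newNeighbors T) k).pending = v :: rest) :
    decodeBlock (searchState (newNeighbors T) (n + 1)).visited (caneCount T)
      (searchState (newNeighbors T) k).visited v =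
        newNeighbors T (searchState (newNeighbors T) k).visited v := by
  have hk : k < n + 1 := lt_of_pending (admissible_newNeighbors T) (by simp [hp])
  have hg := graded_newNeighbors hT hp
  obtain ⟨R, hR⟩ := visited_prefix (B := newNeighbors T) (show k + 1 ≤ n + 1 by omega)
  have hnext := fun y => caneCount_lt_of_next hT (d := n - k) (by omega) hR.symm (y := y)
  rw [decodeBlock, caneCount_of_pending hT hp, ← hR]
  rw [searchState_succ_of_cons hp] at hnext ⊢
  simp only [List.append_assoc, List.drop_left]
  rw [gradedPrefix_append_of_graded hg, gradedPrefix_eq_nil, List.append_nil]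
  intro y hy
  have := hnext y hy
  simp only [List.length_append, List.length_reverse] at this
  omega

theorem searchState_decodeBlock (k : ℕ) :
    searchState (decodeBlock (searchState (newNeighbors T) (n + 1)).visited (caneCount T)) k =
      searchState (newNeighbors T) k :=
  searchState_congr (fun _ _ _ hp => newNeighbors_eq_decodeBlock hT hp) k

end Tree

/-- A labeled tree is determined by the order of visits and the numbers of cane paths. -/
theorem eq_of_visited_eq_of_caneCount_eq {T T' : SimpleGraph (Fin (n + 1))} (hT : T.IsTree)
    (hT' : T'.IsTree) (hv : (nfs T).visited = (nfs T').visited)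
    (hm : caneCount T = caneCount T') : T = T' := by
  rw [nfs_eq_searchState, nfs_eq_searchState] at hv
  have h1 := searchState_decodeBlock hT (n + 1)
  have h2 := searchState_decodeBlock hT' (n + 1)
  rw [hv, hm] at h1
  rw [← searchTree_of_isTree hT, ← searchTree_of_isTree hT', searchTree_eq, searchTree_eq, ← h1, h2]

section Decode

variable {W : List (Fin (n + 1))} {m : Fin (n + 1) → ℕ}

theorem decodeBlock_spec (hnd : W.Nodup) (hchain : W.IsChain (StepRel m))
    {l : List (Fin (n + 1))} (hl : l <+: W) (v : Fin (n + 1)) :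
    Graded m (m v) (decodeBlock W m l v) ∧ (decodeBlock W m l v).Pairwise (· > ·) ∧
      (∀ w ∈ decodeBlock W m l v, w ∉ l) ∧
      ∃ R, W = l ++ decodeBlock W m l v ++ R ∧
        ∀ y ∈ R.head?, m y ≠ m v + (decodeBlock W m l v).length := by
  obtain ⟨R, rfl⟩ := hl
  simp only [decodeBlock, List.drop_left]
  obtain ⟨R', hR'⟩ := gradedPrefix_prefix (m := m) (m v) R
  have hg := graded_gradedPrefix (m := m) (m v) R
  have hne := fun y => ne_of_mem_head?_of_gradedPrefix_append hR'.symm (a := y)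
  generalize gradedPrefix m (m v) R = B at *
  subst hR'
  rw [← List.append_assoc] at hnd hchain
  refine ⟨hg, ?_, ?_, R', by simp, hne⟩
  · rw [← List.isChain_iff_pairwise]
    refine isChain_gt_of_graded hg ?_
    exact (List.isChain_append.1 (List.isChain_append.1 hchain).1).2.1
  · intro w hw hwl
    exact (List.disjoint_of_nodup_append hnd.of_append_left) hwl hw

/-- The third clause is what keeps the decoding alive: while `W` has an unvisited node, the stack is
not empty. -/
theorem decode_invariant (hhead : W.head? = some (Fin.last n))
    (hnd : W.Nodup) (hroot : m (Fin.last n) = 0) (hchain : W.IsChain (StepRel m)) (k : ℕ) :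
    (searchState (decodeBlock W m) k).visited <+: W ∧
      Graded m 0 (searchState (decodeBlock W m) k).pending.reverse ∧
      ∀ R, W = (searchState (decodeBlock W m) k).visited ++ R →
        ∀ y ∈ R.head?, m y < (searchState (decodeBlock W m) k).pending.length := by
  induction k with
  | zero =>
    obtain ⟨W, rfl⟩ : ∃ W', W = Fin.last n :: W' := by
      cases W with
      | nil => simp at hhead
      | cons a W => obtain rfl : a = Fin.last n := by simpa using hhead
                    exact ⟨W, rfl⟩
    refine ⟨by simp, by simp [Graded, hroot], ?_⟩
    intro R hR y hy
    obtain rfl : W = R := by simpa using hR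
    rw [List.isChain_cons] at hchain
    rcases hchain.1 y hy with h | h
    · simp; omega
    -- A rise right after the root is excluded by the clause `a ≠ Fin.last n` of `StepRel`.
    · exact absurd rfl h.2.2
  | succ k ih =>
    rcases hp : (searchState (decodeBlock W m) k).pending with _ | ⟨v, rest⟩
    · rwa [searchState_succ_of_nil hp]
    · obtain ⟨hpre, hgr, hnext⟩ := ih
      obtain ⟨hg, hpw, hnv, R, hR, hy⟩ := decodeBlock_spec hnd hchain hpre v
      rw [searchState_succ_of_cons hp]
      rw [hp, List.reverse_cons, graded_append, List.length_reverse, zero_add] at hgr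
      rw [hp] at hnext
      have hmv := hgr.2.1
      rw [hmv] at hg hy
      simp only [List.reverse_append, List.reverse_reverse]
      generalize decodeBlock W m (searchState (decodeBlock W m) k).visited v = B at *
      refine ⟨⟨R, hR.symm⟩, graded_append.2 ⟨hgr.1, by simpa using hg⟩, ?_⟩
      intro R' hR' y hyR
      obtain rfl : R = R' := List.append_cancel_left (hR.symm.trans hR')
      have hne := hy y hyR
      -- By maximality of the block, `m y` is not the new stack size. It is at most that size: by
      -- the old invariant if the block is empty, and otherwise because `m y ≤ m b + 1` for the last
      -- node `b` of the block.
      rcases B.eq_nil_or_concat with rfl | ⟨B, b, rfl⟩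
      · have := hnext R (hR.trans (by rw [List.append_nil])) y hyR
        simp at hne this ⊢
        omega
      · have h1 := hg.getLast (a := b) (by simp)
        rw [hR, List.isChain_append] at hchain
        have h2 := (hchain.2.2 b (by simp) y hyR).le
        simp only [List.length_append, List.length_reverse] at *
        omega

/-- Every sequence of nodes and numbers subject to the constraints on consecutive entries comes from
a labeled tree. -/
theorem exists_tree (hhead : W.head? = some (Fin.last n)) (hnd : W.Nodup) (hmem : ∀ v, v ∈ W)
    (hroot : m (Fin.last n) = 0) (hchain : W.IsChain (StepRel m)) :
    ∃ T : SimpleGraph (Fin (n + 1)), T.IsTree ∧ (nfs T).visited = W ∧ caneCount T = m := by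
  have hinv := decode_invariant hhead hnd hroot hchain
  have hadm : Admissible (decodeBlock W m) := by
    intro k v rest _
    obtain ⟨_, h1, h2, _⟩ := decodeBlock_spec hnd hchain (hinv k).1 v
    exact ⟨h1, h2⟩
  have hW : (searchState (decodeBlock W m) (n + 1)).visited = W := by
    obtain ⟨⟨R, hR⟩, _, h⟩ := hinv (n + 1)
    have := h R hR.symm
    rw [pending_eq_nil hadm le_rfl] at this
    cases R with
    | nil => simpa using hR
    | cons a R => exact absurd (this a (by simp)) (by simp)
  have hall : ∀ v, v ∈ (searchState (decodeBlock W m) (n + 1)).visited := by rwa [hW]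
  have htree := isTree_fromRel_arcs hadm hall
  have hrun := searchState_newNeighbors_fromRel hadm
  refine ⟨_, htree, ?_, ?_⟩
  · rw [nfs_eq_searchState, hrun, hW]
  · funext v
    obtain ⟨j, _, rest, hj⟩ := exists_active_of_mem_visited hadm (hall v)
    rw [caneCount_of_pending htree (k := j) (r := rest) (by rw [hrun, hj])]
    have := (hinv j).2.1
    rw [hj, List.reverse_cons, graded_append, List.length_reverse, zero_add] at this
    exact this.2.1.symm

end Decode

/-! ### The order simplex and its volume. -/

/-- The simplex of weakly increasing sequences of numbers between `1` and `1 + t`. -/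
def orderSimplex (n : ℕ) (t : ℝ) : Set (Fin n → ℝ) :=
  {y | (∀ k, 1 ≤ y k ∧ y k ≤ 1 + t) ∧ Monotone y}

theorem convex_orderSimplex (n : ℕ) (t : ℝ) : Convex ℝ (orderSimplex n t) := by
  intro x hx y hy a b ha hb hab
  refine ⟨fun k => ?_, fun i j hij => ?_⟩
  · have h1 := hx.1 k
    have h2 := hy.1 k
    simp only [Pi.add_apply, Pi.smul_apply, smul_eq_mul]
    constructor
    · nlinarith [mul_le_mul_of_nonneg_left h1.1 ha, mul_le_mul_of_nonneg_left h2.1 hb]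
    · calc a * x k + b * y k ≤ a * (1 + t) + b * (1 + t) :=
            add_le_add (mul_le_mul_of_nonneg_left h1.2 ha) (mul_le_mul_of_nonneg_left h2.2 hb)
        _ = 1 + t := by rw [← add_mul, hab, one_mul]
  · exact add_le_add (mul_le_mul_of_nonneg_left (hx.2 hij) ha)
      (mul_le_mul_of_nonneg_left (hy.2 hij) hb)

/-- The vertices of the order simplex. -/
def orderVertex (n : ℕ) (t : ℝ) (k : Fin (n + 1)) : Fin n → ℝ :=
  fun i => if i.1 < k.1 then 1 else 1 + t

theorem orderVertex_mem {t : ℝ} (ht : 0 ≤ t) (k : Fin (n + 1)) :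
    orderVertex n t k ∈ orderSimplex n t := by
  refine ⟨fun i => ?_, fun i j hij => ?_⟩
  · unfold orderVertex
    split_ifs <;> constructor <;> linarith
  · have : i.1 ≤ j.1 := hij
    unfold orderVertex
    split_ifs <;> linarith

/-- Coordinates of a combination of vertices are partial sums of the weights. For `t > 0` they
therefore determine the weights once the total is fixed, which yields both affine independence and
barycentric coordinates. -/
theorem sum_smul_orderVertex (t : ℝ) (w : ℕ → ℝ) (i : Fin n) :
    (∑ k : Fin (n + 1), w k • orderVertex n t k) i =
      ∑ k ∈ Finset.range (n + 1), w k + t * ∑ k ∈ Finset.range (i + 1), w k := by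
  have hf : Finset.range (i.1 + 1) = (Finset.range (n + 1)).filter (fun k => ¬ i.1 < k) := by
    ext k
    have := i.2
    simp only [Finset.mem_range, Finset.mem_filter]
    omega
  rw [Finset.sum_apply, hf, Finset.sum_filter, Finset.mul_sum, ← Finset.sum_add_distrib,
    ← Fin.sum_univ_eq_sum_range (fun k => w k + t * if ¬ i.1 < k then w k else 0)]
  refine Finset.sum_congr rfl (fun k _ => ?_)
  simp only [Pi.smul_apply, orderVertex, smul_eq_mul]
  split_ifs <;> ring

theorem affineIndependent_orderVertex {t : ℝ} (ht : 0 < t) :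
    AffineIndependent ℝ (orderVertex n t) := by
  rw [affineIndependent_iff_of_fintype]
  intro w hw hsum
  rw [Finset.weightedVSub_eq_linear_combination _ hw] at hsum
  set w' : ℕ → ℝ := fun k => if h : k < n + 1 then w ⟨k, h⟩ else 0 with hw'
  have hww : ∀ k : Fin (n + 1), w' k = w k := fun k => dif_pos k.2
  have htot : ∑ k ∈ Finset.range (n + 1), w' k = 0 := by
    rw [← Fin.sum_univ_eq_sum_range]
    simp only [hww, hw]
  have hpart : ∀ j ≤ n + 1, ∑ k ∈ Finset.range j, w' k = 0 := by
    intro j hj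
    rcases hj.eq_or_lt with rfl | hj
    · exact htot
    · rcases j with _ | j
      · simp
      · have := sum_smul_orderVertex t w' (⟨j, Nat.lt_of_succ_lt_succ hj⟩ : Fin n)
        simp only [hww, hsum, htot, Pi.zero_apply, zero_add] at this
        rcases mul_eq_zero.1 this.symm with h | h
        · exact absurd h ht.ne'
        · exact h
  intro k
  have h1 := hpart k k.2.le
  have h2 := hpart (k + 1) k.2
  rw [Finset.sum_range_succ, h1, zero_add, hww] at h2
  exact h2

theorem orderSimplex_eq_convexHull {t : ℝ} (ht : 0 < t) :
    orderSimplex n t = convexHull ℝ (Set.range (orderVertex n t)) := by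
  apply Set.Subset.antisymm
  · intro y hy
    -- `z` is `y` framed by `1` and `1 + t`; its increments divided by `t` are the barycentric
    -- coordinates of `y`.
    set z : ℕ → ℝ := fun k => match k with
      | 0 => 1
      | k + 1 => if h : k < n then y ⟨k, h⟩ else 1 + t with hz
    have hz0 : z 0 = 1 := rfl
    have hzs : ∀ k, z (k + 1) = if h : k < n then y ⟨k, h⟩ else 1 + t := fun k => rfl
    have hmono : ∀ k, z k ≤ z (k + 1) := by
      intro k
      rcases k with _ | k
      · rw [hz0, hzs]
        split_ifs with h
        · exact (hy.1 _).1
        · linarith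
      · rw [hzs, hzs]
        split_ifs with h1 h2 h2
        · exact hy.2 (by simp)
        · exact (hy.1 _).2
        · omega
        · exact le_rfl
    have hsum : ∀ j, ∑ k ∈ Finset.range j, (z (k + 1) - z k) / t = (z j - 1) / t := by
      intro j
      rw [← Finset.sum_div, Finset.sum_range_sub, hz0]
    have htot : ∑ k ∈ Finset.range (n + 1), (z (k + 1) - z k) / t = 1 := by
      rw [hsum, hzs, dif_neg (lt_irrefl n)]
      field_simp
      ring
    have hy' : y = ∑ k : Fin (n + 1), ((z (k + 1) - z k) / t) • orderVertex n t k := by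
      funext i
      rw [sum_smul_orderVertex t (fun k => (z (k + 1) - z k) / t), htot, hsum, hzs, dif_pos i.2]
      field_simp
      ring
    rw [hy']
    refine (convex_convexHull ℝ _).sum_mem (fun k _ => ?_) ?_ (fun k _ => ?_)
    · exact div_nonneg (sub_nonneg.2 (hmono k)) ht.le
    · rw [← htot, ← Fin.sum_univ_eq_sum_range (fun k => (z (k + 1) - z k) / t)]
    · exact subset_convexHull ℝ _ ⟨k, rfl⟩
  · refine convexHull_min ?_ (convex_orderSimplex n t)
    rintro _ ⟨k, rfl⟩
    exact orderVertex_mem ht.le k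

theorem isSimplex_orderSimplex {t : ℝ} (ht : 0 < t) : IsSimplex n (orderSimplex n t) :=
  ⟨_, affineIndependent_orderVertex ht, orderSimplex_eq_convexHull ht⟩

theorem isSimplex_singleton (x : Fin n → ℝ) : IsSimplex 0 {x} :=
  ⟨fun _ => x, haveI : Subsingleton (Fin (0 + 1)) := Fin.subsingleton_one
    affineIndependent_of_subsingleton ℝ _, by simp⟩

theorem orderSimplex_zero : orderSimplex n 0 = {fun _ => 1} := by
  ext y
  constructor
  · intro h
    funext k
    have := h.1 k
    linarith
  · rintro rfl
    exact ⟨fun k => by norm_num, fun _ _ _ => le_rfl⟩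

theorem exists_isSimplex_orderSimplex {t : ℝ} (ht : 0 ≤ t) :
    ∃ d, IsSimplex d (orderSimplex n t) := by
  rcases ht.eq_or_lt with rfl | ht
  · exact ⟨0, orderSimplex_zero (n := n) ▸ isSimplex_singleton _⟩
  · exact ⟨n, isSimplex_orderSimplex ht⟩

theorem IsSimplex.preimage {d : ℕ} {s : Set (Fin n → ℝ)} (hs : IsSimplex d s)
    (e : (Fin n → ℝ) ≃ₗ[ℝ] (Fin n → ℝ)) : IsSimplex d (e ⁻¹' s) := by
  obtain ⟨p, hp, rfl⟩ := hs
  refine ⟨e.symm ∘ p, hp.map' e.symm.toLinearMap.toAffineMap e.symm.injective, ?_⟩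
  have h : e ⁻¹' (convexHull ℝ (Set.range p)) = e.symm '' (convexHull ℝ (Set.range p)) := by
    rw [e.image_symm_eq_preimage]
  rw [h, Set.range_comp]
  exact e.symm.toLinearMap.image_convexHull _

theorem measurableSet_orderSimplex (n : ℕ) (t : ℝ) : MeasurableSet (orderSimplex n t) := by
  have : orderSimplex n t =
      (⋂ k, {y | 1 ≤ y k ∧ y k ≤ 1 + t}) ∩ ⋂ i, ⋂ j, ⋂ (_ : i ≤ j), {y | y i ≤ y j} := by
    ext y
    simp [orderSimplex, Monotone]
  rw [this]
  refine MeasurableSet.inter (MeasurableSet.iInter fun k => ?_)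
    (MeasurableSet.iInter fun i => MeasurableSet.iInter fun j => MeasurableSet.iInter fun _ => ?_)
  · exact (measurableSet_le measurable_const (measurable_pi_apply k)).inter
      (measurableSet_le (measurable_pi_apply k) measurable_const)
  · exact measurableSet_le (measurable_pi_apply i) (measurable_pi_apply j)

theorem volume_coord_eq_mul (c : ℝ) {i j : Fin n} (hij : i ≠ j) :
    volume {x : Fin n → ℝ | x i = c * x j} = 0 := by
  let f : (Fin n → ℝ) →ₗ[ℝ] ℝ := LinearMap.proj i - c • LinearMap.proj j
  have h : {x : Fin n → ℝ | x i = c * x j} = (LinearMap.ker f : Set (Fin n → ℝ)) := by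
    ext x
    simp [f, sub_eq_zero]
  rw [h]
  refine Measure.addHaar_submodule volume _ (fun htop => ?_)
  have : (Pi.single i 1 : Fin n → ℝ) ∈ LinearMap.ker f := by rw [htop]; trivial
  simp [f, hij.symm] at this

theorem volume_coord_eq (c : ℝ) (i : Fin n) : volume {x : Fin n → ℝ | x i = c} = 0 :=
  Measure.pi_hyperplane (fun _ : Fin n => (volume : Measure ℝ)) i c

theorem perm_eq_of_monotone {y : Fin n → ℝ} (hy : Function.Injective y)
    {σ τ : Equiv.Perm (Fin n)} (hσ : Monotone (y ∘ σ)) (hτ : Monotone (y ∘ τ)) : σ = τ := by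
  have := Tuple.unique_monotone hσ hτ
  ext k
  exact congrArg Fin.val (hy (congrFun this k))

theorem volume_not_injective : volume {y : Fin n → ℝ | ¬ Function.Injective y} = 0 := by
  have : {y : Fin n → ℝ | ¬ Function.Injective y} ⊆
      ⋃ (i : Fin n) (j : Fin n) (_ : i ≠ j), {x : Fin n → ℝ | x i = 1 * x j} := by
    intro y hy
    simp only [Function.Injective, Set.mem_ofPred_eq, not_forall] at hy
    obtain ⟨i, j, h, hij⟩ := hy
    simp only [Set.mem_iUnion]
    exact ⟨i, j, hij, by simp [h]⟩
  refine measure_mono_null this ?_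
  simp only [measure_iUnion_null_iff]
  exact fun i j hij => volume_coord_eq_mul 1 hij

theorem measurePreserving_comp (σ : Equiv.Perm (Fin n)) :
    MeasurePreserving (fun y : Fin n → ℝ => y ∘ σ) volume volume := by
  have := volume_measurePreserving_piCongrLeft (fun _ : Fin n => ℝ) σ.symm
  convert this using 1
  funext y k
  obtain ⟨i, rfl⟩ := σ.symm.surjective k
  rw [MeasurableEquiv.coe_piCongrLeft, Equiv.piCongrLeft_apply_apply]
  simp

/-- The cube of side `t` is the union of the `n!` coordinate permutations of the order simplex,
which overlap only where two coordinates agree. -/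
theorem factorial_mul_volume_orderSimplex (t : ℝ) :
    (n ! : ℝ≥0∞) * volume (orderSimplex n t) = ENNReal.ofReal t ^ n := by
  have hcube : Set.Icc (fun _ => 1) (fun _ => 1 + t) =
      ⋃ σ : Equiv.Perm (Fin n), (fun y : Fin n → ℝ => y ∘ σ) ⁻¹' orderSimplex n t := by
    ext y
    simp only [Set.mem_Icc, Set.mem_iUnion, Set.mem_preimage]
    constructor
    · rintro ⟨h1, h2⟩
      exact ⟨Tuple.sort y, fun k => ⟨h1 _, h2 _⟩, Tuple.monotone_sort y⟩
    · rintro ⟨σ, h, _⟩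
      refine ⟨fun k => ?_, fun k => ?_⟩
      · simpa using (h (σ.symm k)).1
      · simpa using (h (σ.symm k)).2
  have hvol : ∀ σ : Equiv.Perm (Fin n),
      volume ((fun y : Fin n → ℝ => y ∘ σ) ⁻¹' orderSimplex n t) = volume (orderSimplex n t) :=
    fun σ => (measurePreserving_comp σ).measure_preimage
      (measurableSet_orderSimplex n t).nullMeasurableSet
  have h := measure_iUnion₀ (μ := (volume : Measure (Fin n → ℝ)))
    (f := fun σ : Equiv.Perm (Fin n) => (fun y : Fin n → ℝ => y ∘ σ) ⁻¹' orderSimplex n t) ?_ ?_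
  · rw [← hcube, Real.volume_Icc_pi, tsum_fintype] at h
    simp only [hvol, add_sub_cancel_left, Finset.prod_const, Finset.sum_const, Finset.card_univ,
      Fintype.card_perm, Fintype.card_fin, nsmul_eq_mul] at h
    exact h.symm
  · intro σ τ hστ
    refine measure_mono_null ?_ volume_not_injective
    rintro y ⟨h1, h2⟩ hy
    exact hστ (perm_eq_of_monotone hy h1.2 h2.2)
  · intro σ
    exact ((measurePreserving_comp σ).measurable
      (measurableSet_orderSimplex n t)).nullMeasurableSet

/-- The linear map that sends `x` to the sequence of the numbers `x (σ k) / c k`. -/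
noncomputable def permScale (σ : Equiv.Perm (Fin n)) (c : Fin n → ℝ) (hc : ∀ k, 0 < c k) :
    (Fin n → ℝ) ≃ₗ[ℝ] (Fin n → ℝ) where
  toFun x k := x (σ k) / c k
  map_add' x y := by funext k; simp [add_div]
  map_smul' a x := by funext k; simp [mul_div_assoc]
  invFun y i := c (σ.symm i) * y (σ.symm i)
  left_inv x := by
    funext i
    have := (hc (σ.symm i)).ne'
    simp; field_simp
  right_inv y := by
    funext k
    have := (hc k).ne'
    simp; field_simp

@[simp] theorem permScale_apply (σ : Equiv.Perm (Fin n)) (c : Fin n → ℝ) (hc : ∀ k, 0 < c k)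
    (x : Fin n → ℝ) (k : Fin n) : permScale σ c hc x k = x (σ k) / c k := rfl

/-- The map is a permutation of coordinates, which preserves volume, followed by the diagonal matrix
with entries `(c k)⁻¹`. -/
theorem volume_preimage_permScale (σ : Equiv.Perm (Fin n)) (c : Fin n → ℝ) (hc : ∀ k, 0 < c k)
    {s : Set (Fin n → ℝ)} (hs : MeasurableSet s) :
    volume (permScale σ c hc ⁻¹' s) = ENNReal.ofReal (∏ k, c k) * volume s := by
  have hprod : 0 < ∏ k, c k := Finset.prod_pos (fun k _ => hc k)
  have hdet : (Matrix.diagonal fun k => (c k)⁻¹).det = (∏ k, c k)⁻¹ := by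
    rw [Matrix.det_diagonal, Finset.prod_inv_distrib]
  have h1 := Real.smul_map_diagonal_volume_pi (D := fun k => (c k)⁻¹)
    (by rw [hdet]; exact (inv_pos.2 hprod).ne')
  have hmeas : Measurable (Matrix.toLin' (Matrix.diagonal fun k => (c k)⁻¹)) :=
    (LinearMap.continuous_on_pi _).measurable
  have h2 : permScale σ c hc ⁻¹' s = (fun y : Fin n → ℝ => y ∘ σ) ⁻¹'
      (Matrix.toLin' (Matrix.diagonal fun k => (c k)⁻¹) ⁻¹' s) := by
    rw [← Set.preimage_comp]
    congr 1
    funext x k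
    simp [Matrix.mulVec_diagonal, div_eq_inv_mul]
  rw [h2, (measurePreserving_comp σ).measure_preimage (hmeas hs).nullMeasurableSet]
  conv_rhs => rw [← h1]
  rw [Measure.smul_apply, Measure.map_apply hmeas hs, hdet, abs_of_pos (inv_pos.2 hprod),
    smul_eq_mul, ← mul_assoc, ← ENNReal.ofReal_mul hprod.le, mul_inv_cancel₀ hprod.ne',
    ENNReal.ofReal_one, one_mul]

/-! ### Codes of labeled trees and the simplices in terms of them. -/

/-- The constraints on consecutive visited nodes, in terms of the labels `ρ i` of the visited nodes
and of the numbers `μ i` of cane paths starting in them. -/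
def IsCode (ρ : Equiv.Perm (Fin n)) (μ : Fin n → ℕ) : Prop :=
  (∀ i : Fin n, i.1 = 0 → μ i = 0) ∧
    ∀ (i : ℕ) (hi : i + 1 < n), μ ⟨i + 1, hi⟩ ≤ μ ⟨i, i.lt_succ_self.trans hi⟩ ∨
      (μ ⟨i + 1, hi⟩ = μ ⟨i, i.lt_succ_self.trans hi⟩ + 1 ∧
        ρ ⟨i + 1, hi⟩ < ρ ⟨i, i.lt_succ_self.trans hi⟩)

/-- The nodes in the order `ρ`, preceded by the root. -/
def visitOrder (ρ : Equiv.Perm (Fin n)) : List (Fin (n + 1)) :=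
  Fin.last n :: List.ofFn (fun i => (ρ i).castSucc)

/-- The tree `T` visits the nodes in the order `ρ`, and there are `μ i` cane paths starting in the
`i`-th of them. -/
def HasCode (T : SimpleGraph (Fin (n + 1))) (ρ : Equiv.Perm (Fin n)) (μ : Fin n → ℕ) : Prop :=
  (nfs T).visited = visitOrder ρ ∧ ∀ i, caneCount T (ρ i).castSucc = μ i

theorem mem_visitOrder (ρ : Equiv.Perm (Fin n)) (v : Fin (n + 1)) : v ∈ visitOrder ρ := by
  rw [visitOrder, List.mem_cons, List.mem_ofFn]
  refine v.lastCases (Or.inl rfl) (fun k => Or.inr ⟨ρ.symm k, by simp⟩)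

theorem visitOrder_nodup (ρ : Equiv.Perm (Fin n)) : (visitOrder ρ).Nodup := by
  rw [visitOrder, List.nodup_cons, List.nodup_ofFn, List.mem_ofFn]
  refine ⟨?_, fun i j h => ρ.injective (Fin.castSucc_injective n h)⟩
  rintro ⟨i, hi⟩
  exact (Fin.castSucc_lt_last _).ne hi

/-- The link from the root to the first node becomes the condition that `μ` starts at 0. -/
theorem isChain_visitOrder {ρ : Equiv.Perm (Fin n)} {m : Fin (n + 1) → ℕ}
    (hm : m (Fin.last n) = 0) :
    (visitOrder ρ).IsChain (StepRel m) ↔ IsCode ρ (fun i => m (ρ i).castSucc) := by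
  rw [visitOrder, List.isChain_cons, List.isChain_ofFn]
  refine and_congr ?_ (forall₂_congr fun i hi => ?_)
  · constructor
    · intro h i hi
      have := h (ρ i).castSucc (by
        obtain ⟨i, hin⟩ := i
        obtain rfl : i = 0 := hi
        cases n with
        | zero => exact absurd hin (lt_irrefl 0)
        | succ n => simp)
      rcases this with h | h
      · exact Nat.le_zero.1 (hm ▸ h)
      · exact absurd rfl h.2.2
    · intro h b hb
      cases n with
      | zero => simp at hb
      | succ n =>
        have hb : (ρ 0).castSucc = b := by simpa using hb
        exact Or.inl (by rw [← hb, show m (ρ 0).castSucc = 0 from h 0 rfl]; exact Nat.zero_le _)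
  · refine or_congr_right (and_congr_right fun _ => ?_)
    rw [Fin.castSucc_lt_castSucc_iff]
    exact and_iff_left (Fin.castSucc_lt_last _).ne

theorem exists_hasCode {T : SimpleGraph (Fin (n + 1))} (hT : T.IsTree) :
    ∃ ρ μ, IsCode ρ μ ∧ HasCode T ρ μ := by
  have hnd := visited_nodup (admissible_newNeighbors T) (n + 1)
  have hlen := length_eq_of_forall_mem hnd (mem_visited_of_connected hT.connected)
  have heq := visited_eq (B := newNeighbors T) (n + 1)
  generalize List.map Prod.snd (searchState (newNeighbors T) (n + 1)).arcs = l at heq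
  rw [heq] at hnd hlen
  rw [List.length_cons, Nat.add_right_cancel_iff] at hlen
  rw [List.nodup_cons] at hnd
  have hne : ∀ i : Fin n, l[i.1] ≠ Fin.last n := fun i h => hnd.1 (h ▸ List.getElem_mem _)
  have hinj : Function.Injective (fun i : Fin n => (l[i.1]).castPred (hne i)) := by
    intro i j h
    have := congrArg Fin.castSucc h
    simp only [Fin.castSucc_castPred] at this
    exact Fin.ext ((hnd.2.getElem_inj_iff).1 this)
  let ρ := Equiv.ofBijective _ (Finite.injective_iff_bijective.1 hinj)
  have hρ : (searchState (newNeighbors T) (n + 1)).visited = visitOrder ρ := by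
    rw [heq, visitOrder]
    congr 1
    apply List.ext_getElem
    · simp [hlen]
    · intro i h1 h2
      simp [ρ]
  refine ⟨ρ, fun i => caneCount T (ρ i).castSucc, ?_, ?_, fun _ => rfl⟩
  · rw [← isChain_visitOrder (caneCount_last hT), ← hρ]
    exact (isChain_visited hT (n + 1)).1
  · rw [nfs_eq_searchState, hρ]

theorem exists_tree_hasCode {ρ : Equiv.Perm (Fin n)} {μ : Fin n → ℕ} (h : IsCode ρ μ) :
    ∃ T : SimpleGraph (Fin (n + 1)), T.IsTree ∧ HasCode T ρ μ := by
  let m : Fin (n + 1) → ℕ := Fin.lastCases 0 (fun k => μ (ρ.symm k))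
  have hm0 : m (Fin.last n) = 0 := by simp [m]
  have hm : ∀ i, m (ρ i).castSucc = μ i := fun i => by simp [m]
  obtain ⟨T, hT, hv, hc⟩ := exists_tree (W := visitOrder ρ) (m := m) rfl (visitOrder_nodup ρ)
    (mem_visitOrder ρ) hm0 ((isChain_visitOrder hm0).2 (by simpa only [hm] using h))
  exact ⟨T, hT, hv, fun i => by rw [hc, hm]⟩

theorem HasCode.eq {T T' : SimpleGraph (Fin (n + 1))} (hT : T.IsTree) (hT' : T'.IsTree)
    {ρ : Equiv.Perm (Fin n)} {μ : Fin n → ℕ} (h : HasCode T ρ μ) (h' : HasCode T' ρ μ) :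
    T = T' := by
  refine eq_of_visited_eq_of_caneCount_eq hT hT' (h.1.trans h'.1.symm) (funext fun v => ?_)
  refine v.lastCases ?_ (fun k => ?_)
  · rw [caneCount_last hT, caneCount_last hT']
  · have h1 := h.2 (ρ.symm k)
    have h2 := h'.2 (ρ.symm k)
    rw [Equiv.apply_symm_apply] at h1 h2
    rw [h1, h2]

theorem HasCode.nfsPosition_eq {T : SimpleGraph (Fin (n + 1))} {ρ : Equiv.Perm (Fin n)}
    {μ : Fin n → ℕ} (h : HasCode T ρ μ) (i : Fin n) : nfsPosition T (ρ i).castSucc = i + 1 := by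
  have hlen : i.1 + 1 < (visitOrder ρ).length := by simp [visitOrder]
  have := (visitOrder_nodup ρ).idxOf_getElem (i.1 + 1) hlen
  rw [nfsPosition, h.1]
  convert this using 2
  simp [visitOrder]

theorem HasCode.nodeCoord_eq {T : SimpleGraph (Fin (n + 1))} {ρ : Equiv.Perm (Fin n)}
    {μ : Fin n → ℕ} (h : HasCode T ρ μ) (t : ℝ) (x : Fin n → ℝ) (i : Fin n) :
    nodeCoord T t x (ρ i).castSucc = x i / (1 + t) ^ μ i := by
  rw [nodeCoord, h.nfsPosition_eq, h.2, coord, dif_pos i.2]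

theorem HasCode.treeSimplex_eq_preimage {T : SimpleGraph (Fin (n + 1))} {ρ : Equiv.Perm (Fin n)}
    {μ : Fin n → ℕ} (h : HasCode T ρ μ) {t : ℝ} (ht : 0 < 1 + t) :
    treeSimplex T t = permScale ρ.symm (fun k => (1 + t) ^ caneCount T k.castSucc)
      (fun _ => pow_pos ht _) ⁻¹' orderSimplex n t := by
  have hcoord : ∀ x, (fun k : Fin n => nodeCoord T t x k.castSucc) =
      permScale ρ.symm (fun k => (1 + t) ^ caneCount T k.castSucc) (fun _ => pow_pos ht _) x := by
    intro x
    funext k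
    obtain ⟨i, rfl⟩ := ρ.surjective k
    rw [h.nodeCoord_eq, permScale_apply, h.2, Equiv.symm_apply_apply]
  ext x
  rw [Set.mem_preimage, ← hcoord]
  rfl

theorem factorial_mul_volume_treeSimplex {T : SimpleGraph (Fin (n + 1))} (hT : T.IsTree) {t : ℝ}
    (ht : 0 ≤ t) :
    (n ! : ℝ≥0∞) * volume (treeSimplex T t) = ENNReal.ofReal (t ^ n * (1 + t) ^ alpha T) := by
  obtain ⟨ρ, μ, _, h⟩ := exists_hasCode hT
  have ht' : 0 < 1 + t := by linarith
  rw [h.treeSimplex_eq_preimage ht', volume_preimage_permScale _ _ _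
    (measurableSet_orderSimplex n t), Finset.prod_pow_eq_pow_sum, mul_left_comm,
    factorial_mul_volume_orderSimplex, alpha, Fin.sum_univ_castSucc, caneCount_last hT, add_zero,
    ← ENNReal.ofReal_pow ht, ← ENNReal.ofReal_mul (pow_nonneg ht'.le _), mul_comm]

/-! ### The cells cover the polytope. -/

/-- The set `S_T(t)` in terms of the code of the tree `T`, with `q = 1 + t`. -/
def cell (ρ : Equiv.Perm (Fin n)) (μ : Fin n → ℕ) (q : ℝ) : Set (Fin n → ℝ) :=
  {x | (∀ i, q ^ μ i ≤ x i ∧ x i ≤ q ^ (μ i + 1)) ∧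
    ∀ i j, ρ i ≤ ρ j → x i * q ^ μ j ≤ x j * q ^ μ i}

theorem HasCode.treeSimplex_eq_cell {T : SimpleGraph (Fin (n + 1))} {ρ : Equiv.Perm (Fin n)}
    {μ : Fin n → ℕ} (h : HasCode T ρ μ) {t : ℝ} (ht : 0 < 1 + t) :
    treeSimplex T t = cell ρ μ (1 + t) := by
  ext x
  refine and_congr ?_ ?_
  · rw [← ρ.forall_congr_right]
    refine forall_congr' fun i => ?_
    rw [h.nodeCoord_eq, le_div_iff₀ (pow_pos ht _), one_mul, div_le_iff₀ (pow_pos ht _), pow_succ']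
  · rw [Monotone, ← ρ.forall_congr_right]
    refine forall_congr' fun i => ?_
    rw [← ρ.forall_congr_right]
    refine forall_congr' fun j => imp_congr_right fun _ => ?_
    simp only [h.nodeCoord_eq]
    rw [div_le_div_iff₀ (pow_pos ht _) (pow_pos ht _)]

/-- If `μ` does not rise, the bounds on single coordinates suffice. If it rises by 1, the drop of
label makes the comparison of scaled coordinates read exactly `x (i + 1) ≤ q * x i`. -/
theorem cell_subset_cayleyPolytope {ρ : Equiv.Perm (Fin n)} {μ : Fin n → ℕ} (h : IsCode ρ μ)
    {t : ℝ} (ht : 0 ≤ t) : cell ρ μ (1 + t) ⊆ cayleyPolytope n t := by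
  have hq : 1 ≤ 1 + t := by linarith
  have hq0 : 0 < 1 + t := by linarith
  intro x hx i
  refine ⟨(one_le_pow₀ hq).trans (hx.1 i).1, ?_⟩
  obtain ⟨i, hi⟩ := i
  rcases i with _ | i
  · have := (hx.1 ⟨0, hi⟩).2
    rw [h.1 ⟨0, hi⟩ rfl] at this
    simpa [coord] using this
  · have hi' : i < n := i.lt_succ_self.trans hi
    simp only [coord, dif_pos hi']
    rcases h.2 i hi with hμ | ⟨hμ, hρ⟩
    · calc x ⟨i + 1, hi⟩ ≤ (1 + t) ^ (μ ⟨i + 1, hi⟩ + 1) := (hx.1 _).2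
        _ ≤ (1 + t) ^ (μ ⟨i, hi'⟩ + 1) := pow_le_pow_right₀ hq (by omega)
        _ = (1 + t) * (1 + t) ^ μ ⟨i, hi'⟩ := pow_succ' _ _
        _ ≤ (1 + t) * x ⟨i, hi'⟩ := mul_le_mul_of_nonneg_left (hx.1 _).1 hq0.le
    · have := hx.2 _ _ hρ.le
      rw [hμ, pow_succ', ← mul_assoc, mul_comm (x ⟨i, hi'⟩)] at this
      exact le_of_mul_le_mul_right this (pow_pos hq0 _)

theorem exists_cell_of_mem_cayleyPolytope {t : ℝ} (ht : 0 < t) {x : Fin n → ℝ}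
    (hx : x ∈ cayleyPolytope n t) : ∃ ρ μ, IsCode ρ μ ∧ x ∈ cell ρ μ (1 + t) := by
  classical
  have hq : 1 < 1 + t := by linarith
  have hq0 : 0 < 1 + t := by linarith
  have hex : ∀ i, ∃ m : ℕ, x i ≤ (1 + t) ^ (m + 1) := by
    intro i
    obtain ⟨m, hm⟩ := pow_unbounded_of_one_lt (x i) hq
    exact ⟨m, hm.le.trans (pow_le_pow_right₀ hq.le (Nat.le_succ m))⟩
  let μ : Fin n → ℕ := fun i => Nat.find (hex i)
  have hup : ∀ i, x i ≤ (1 + t) ^ (μ i + 1) := fun i => Nat.find_spec (hex i)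
  have hmin : ∀ i m, x i ≤ (1 + t) ^ (m + 1) → μ i ≤ m := fun i m h => Nat.find_min' (hex i) h
  have hlow : ∀ i, (1 + t) ^ μ i ≤ x i := by
    intro i
    rcases hμ : μ i with _ | m
    · simpa using (hx i).1
    · by_contra h
      have := hmin i m (not_le.1 h).le
      omega
  -- Ties between scaled coordinates give the smaller label to the later position. This is needed
  -- when `x (i + 1) = q * x i` and `μ` rises, since a code then demands a drop of label.
  let f : Fin n → ℝ ×ₗ (Fin n)ᵒᵈ := fun i => toLex (x i / (1 + t) ^ μ i, OrderDual.toDual i)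
  have hf : Monotone (f ∘ Tuple.sort f) := Tuple.monotone_sort f
  let ρ : Equiv.Perm (Fin n) := (Tuple.sort f).symm
  have hρ : ∀ i j, ρ i ≤ ρ j → f i ≤ f j := by
    intro i j hij
    simpa [ρ] using hf hij
  refine ⟨ρ, μ, ⟨?_, ?_⟩, fun i => ⟨hlow i, hup i⟩, ?_⟩
  · rintro ⟨i, hi⟩ rfl
    refine Nat.le_zero.1 (hmin _ 0 ?_)
    simpa [coord] using (hx ⟨0, hi⟩).2
  · intro i hi
    have hi' : i < n := i.lt_succ_self.trans hi
    have hstep : x ⟨i + 1, hi⟩ ≤ (1 + t) * x ⟨i, hi'⟩ := by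
      simpa [coord, hi'] using (hx ⟨i + 1, hi⟩).2
    have hle : μ ⟨i + 1, hi⟩ ≤ μ ⟨i, hi'⟩ + 1 := by
      apply hmin
      rw [pow_succ']
      exact hstep.trans (mul_le_mul_of_nonneg_left (hup _) hq0.le)
    rcases Nat.lt_or_ge (μ ⟨i, hi'⟩) (μ ⟨i + 1, hi⟩) with hlt | hge
    · right
      have heq : μ ⟨i + 1, hi⟩ = μ ⟨i, hi'⟩ + 1 := le_antisymm hle hlt
      refine ⟨heq, ?_⟩
      by_contra hnot
      have hle' := hρ _ _ (not_lt.1 hnot)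
      rw [Prod.Lex.toLex_le_toLex] at hle'
      rcases hle' with h | ⟨_, h⟩
      · rw [heq, div_lt_div_iff₀ (pow_pos hq0 _) (pow_pos hq0 _), pow_succ', ← mul_assoc,
          mul_comm (x ⟨i, hi'⟩)] at h
        exact absurd (lt_of_mul_lt_mul_right h (pow_pos hq0 _).le) (not_lt.2 hstep)
      · have h : i + 1 ≤ i := h
        omega
    · exact Or.inl hge
  · intro i j hij
    rw [← div_le_div_iff₀ (pow_pos hq0 _) (pow_pos hq0 _)]
    rcases Prod.Lex.toLex_le_toLex.1 (hρ i j hij) with h | ⟨h, _⟩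
    · exact h.le
    · exact h.le

theorem iUnion_treeSimplex {t : ℝ} (ht : 0 < t) :
    ⋃ T : {T : SimpleGraph (Fin (n + 1)) // T.IsTree}, treeSimplex T.1 t = cayleyPolytope n t := by
  have hq : 0 < 1 + t := by linarith
  ext x
  rw [Set.mem_iUnion]
  constructor
  · rintro ⟨⟨T, hT⟩, hx⟩
    obtain ⟨ρ, μ, hc, h⟩ := exists_hasCode hT
    rw [h.treeSimplex_eq_cell hq] at hx
    exact cell_subset_cayleyPolytope hc ht.le hx
  · intro hx
    obtain ⟨ρ, μ, hc, hx⟩ := exists_cell_of_mem_cayleyPolytope ht hx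
    obtain ⟨T, hT, h⟩ := exists_tree_hasCode hc
    exact ⟨⟨T, hT⟩, by rwa [h.treeSimplex_eq_cell hq]⟩

/-! ### Overlaps are null sets and common faces. -/

theorem code_eq_of_mem_cell {ρ ρ' : Equiv.Perm (Fin n)} {μ μ' : Fin n → ℕ} {q : ℝ} (hq : 1 < q)
    {x : Fin n → ℝ} (hx : x ∈ cell ρ μ q) (hx' : x ∈ cell ρ' μ' q) (h1 : ∀ i (k : ℕ), x i ≠ q ^ k)
    (h2 : ∀ i j, i ≠ j → ∀ k l : ℕ, x i ≠ q ^ k / q ^ l * x j) : ρ = ρ' ∧ μ = μ' := by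
  have hq0 : 0 < q := by linarith
  have hlt : ∀ {ρ ρ' : Equiv.Perm (Fin n)} {μ μ' : Fin n → ℕ}, x ∈ cell ρ μ q →
      x ∈ cell ρ' μ' q → ∀ i, μ i ≤ μ' i := by
    intro ρ ρ' μ μ' hx hx' i
    have := (hx.1 i).1.trans_lt (lt_of_le_of_ne (hx'.1 i).2 (h1 i _))
    exact Nat.lt_succ_iff.1 ((pow_lt_pow_iff_right₀ hq).1 this)
  have hμ : μ = μ' := funext fun i => le_antisymm (hlt hx hx' i) (hlt hx' hx i)
  subst hμ
  refine ⟨?_, rfl⟩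
  have hinj : Function.Injective (fun i => x i / q ^ μ i) := by
    intro i j hij
    by_contra hne
    refine h2 i j hne (μ i) (μ j) ?_
    have hi := pow_ne_zero (μ i) hq0.ne'
    have hj := pow_ne_zero (μ j) hq0.ne'
    have hij : x i / q ^ μ i = x j / q ^ μ j := hij
    rw [div_eq_iff hi] at hij
    rw [hij]
    ring
  have hmono : ∀ {ρ : Equiv.Perm (Fin n)}, x ∈ cell ρ μ q →
      Monotone ((fun i => x i / q ^ μ i) ∘ ρ.symm) := by
    intro ρ hx i j hij
    have := hx.2 (ρ.symm i) (ρ.symm j) (by simpa using hij)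
    exact (div_le_div_iff₀ (pow_pos hq0 _) (pow_pos hq0 _)).2 this
  have := perm_eq_of_monotone hinj (hmono hx) (hmono hx')
  simpa using congrArg Equiv.symm this

theorem volume_cell_inter {ρ ρ' : Equiv.Perm (Fin n)} {μ μ' : Fin n → ℕ} {q : ℝ} (hq : 1 < q)
    (hne : ¬ (ρ = ρ' ∧ μ = μ')) : volume (cell ρ μ q ∩ cell ρ' μ' q) = 0 := by
  have hsub : cell ρ μ q ∩ cell ρ' μ' q ⊆
      (⋃ (i : Fin n) (k : ℕ), {x : Fin n → ℝ | x i = q ^ k}) ∪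
        ⋃ (i : Fin n) (j : Fin n) (_ : i ≠ j) (k : ℕ) (l : ℕ),
          {x : Fin n → ℝ | x i = q ^ k / q ^ l * x j} := by
    rintro x ⟨hx, hx'⟩
    by_contra h
    simp only [Set.mem_union, Set.mem_iUnion, not_or, not_exists] at h
    exact hne (code_eq_of_mem_cell hq hx hx' h.1 h.2)
  refine measure_mono_null hsub (measure_union_null ?_ ?_)
  · simp only [measure_iUnion_null_iff]
    exact fun i k => volume_coord_eq _ i
  · simp only [measure_iUnion_null_iff]
    exact fun i j hij k l => volume_coord_eq_mul _ hij

theorem volume_treeSimplex_inter {t : ℝ} (ht : 0 < t) {T T' : SimpleGraph (Fin (n + 1))}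
    (hT : T.IsTree) (hT' : T'.IsTree) (hne : T ≠ T') :
    volume (treeSimplex T t ∩ treeSimplex T' t) = 0 := by
  have hq : 0 < 1 + t := by linarith
  obtain ⟨ρ, μ, _, h⟩ := exists_hasCode hT
  obtain ⟨ρ', μ', _, h'⟩ := exists_hasCode hT'
  rw [h.treeSimplex_eq_cell hq, h'.treeSimplex_eq_cell hq]
  refine volume_cell_inter (by linarith) ?_
  rintro ⟨rfl, rfl⟩
  exact hne (h.eq hT hT' h')

/-- Here `u` and `v` are the values at the ends of a segment of an affine functional that does not
change sign on a cell: if it is nonnegative at an inner point, it is so at the ends. -/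
theorem nonneg_of_combination_nonneg {a b u v : ℝ} (ha : 0 < a) (hb : 0 < b)
    (h : 0 ≤ u ∨ (u ≤ 0 ∧ v ≤ 0)) (hz : 0 ≤ a * u + b * v) : 0 ≤ u := by
  rcases h with h | ⟨_, hv⟩
  · exact h
  · have : 0 ≤ a * u := by linarith [mul_nonpos_of_nonneg_of_nonpos hb.le hv]
    exact nonneg_of_mul_nonneg_right this ha

theorem le_pow_or_pow_le_of_mem_cell {ρ : Equiv.Perm (Fin n)} {μ : Fin n → ℕ} {q : ℝ} (hq : 1 ≤ q)
    (i : Fin n) (k : ℕ) : (∀ x ∈ cell ρ μ q, q ^ k ≤ x i) ∨ ∀ x ∈ cell ρ μ q, x i ≤ q ^ k := by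
  rcases Nat.lt_or_ge (μ i) k with h | h
  · exact Or.inr fun x hx => (hx.1 i).2.trans (pow_le_pow_right₀ hq h)
  · exact Or.inl fun x hx => (pow_le_pow_right₀ hq h).trans (hx.1 i).1

/-- On a cell, the ratio of two coordinates does not cross any power of `q`. -/
theorem mul_pow_le_mul_pow_of_mem_cell {ρ : Equiv.Perm (Fin n)} {μ : Fin n → ℕ} {q : ℝ}
    (hq : 1 ≤ q) {i j : Fin n} {k l : ℕ}
    (h : μ i + l < μ j + k ∨ (μ i + l = μ j + k ∧ ρ i ≤ ρ j)) {x : Fin n → ℝ}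
    (hx : x ∈ cell ρ μ q) : x i * q ^ l ≤ x j * q ^ k := by
  have hq0 : 0 < q := by linarith
  rcases h with h | ⟨h, hρ⟩
  · calc x i * q ^ l ≤ q ^ (μ i + 1) * q ^ l :=
          mul_le_mul_of_nonneg_right (hx.1 i).2 (pow_pos hq0 _).le
      _ = q ^ (μ i + l + 1) := by ring
      _ ≤ q ^ (μ j + k) := pow_le_pow_right₀ hq h
      _ = q ^ μ j * q ^ k := pow_add _ _ _
      _ ≤ x j * q ^ k := mul_le_mul_of_nonneg_right (hx.1 j).1 (pow_pos hq0 _).le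
  · refine le_of_mul_le_mul_right ?_ (pow_pos hq0 (μ i))
    calc x i * q ^ l * q ^ μ i = x i * q ^ (μ i + l) := by ring
      _ = x i * q ^ μ j * q ^ k := by rw [h]; ring
      _ ≤ x j * q ^ μ i * q ^ k :=
          mul_le_mul_of_nonneg_right (hx.2 i j hρ) (pow_pos hq0 _).le
      _ = x j * q ^ k * q ^ μ i := by ring

/-- Each inequality defining the second cell compares with a hyperplane that the first cell does not
cross, so it passes from an inner point of a segment in the first cell to its ends. -/
theorem isExtreme_cell_inter (ρ ρ' : Equiv.Perm (Fin n)) (μ μ' : Fin n → ℕ) {q : ℝ} (hq : 1 ≤ q) :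
    IsExtreme ℝ (cell ρ μ q) (cell ρ μ q ∩ cell ρ' μ' q) := by
  refine ⟨Set.inter_subset_left, ?_⟩
  rintro x hx y hy z ⟨_, hz⟩ ⟨a, b, ha, hb, hab, rfl⟩
  refine ⟨hx, fun i => ⟨?_, ?_⟩, fun i j hij => ?_⟩
  · have h := (hz.1 i).1
    simp only [Pi.add_apply, Pi.smul_apply, smul_eq_mul] at h
    rw [← sub_nonneg]
    refine nonneg_of_combination_nonneg ha hb (v := y i - q ^ μ' i) ?_ ?_
    · rcases le_pow_or_pow_le_of_mem_cell (ρ := ρ) (μ := μ) hq i (μ' i) with h | h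
      · exact Or.inl (sub_nonneg.2 (h x hx))
      · exact Or.inr ⟨sub_nonpos.2 (h x hx), sub_nonpos.2 (h y hy)⟩
    · have : a * (x i - q ^ μ' i) + b * (y i - q ^ μ' i) =
          a * x i + b * y i - (a + b) * q ^ μ' i := by ring
      rw [this, hab]; linarith
  · have h := (hz.1 i).2
    simp only [Pi.add_apply, Pi.smul_apply, smul_eq_mul] at h
    rw [← sub_nonneg]
    refine nonneg_of_combination_nonneg ha hb (v := q ^ (μ' i + 1) - y i) ?_ ?_
    · rcases le_pow_or_pow_le_of_mem_cell (ρ := ρ) (μ := μ) hq i (μ' i + 1) with h | h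
      · exact Or.inr ⟨sub_nonpos.2 (h x hx), sub_nonpos.2 (h y hy)⟩
      · exact Or.inl (sub_nonneg.2 (h x hx))
    · have : a * (q ^ (μ' i + 1) - x i) + b * (q ^ (μ' i + 1) - y i) =
          (a + b) * q ^ (μ' i + 1) - (a * x i + b * y i) := by ring
      rw [this, hab]; linarith
  · have h := hz.2 i j hij
    simp only [Pi.add_apply, Pi.smul_apply, smul_eq_mul] at h
    rw [← sub_nonneg]
    refine nonneg_of_combination_nonneg ha hb (v := y j * q ^ μ' i - y i * q ^ μ' j) ?_ (by linarith)
    -- The lexicographic comparison of exponents, then labels, decides on which side of the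
    -- hyperplane the whole first cell lies.
    by_cases hc : μ i + μ' j < μ j + μ' i ∨ (μ i + μ' j = μ j + μ' i ∧ ρ i ≤ ρ j)
    · exact Or.inl (sub_nonneg.2 (mul_pow_le_mul_pow_of_mem_cell hq hc hx))
    · have hc' : μ j + μ' i < μ i + μ' j ∨ (μ j + μ' i = μ i + μ' j ∧ ρ j ≤ ρ i) := by
        rcases lt_trichotomy (μ i + μ' j) (μ j + μ' i) with h | h | h
        · exact absurd (Or.inl h) hc
        · exact Or.inr ⟨h.symm, le_of_not_ge fun hle => hc (Or.inr ⟨h, hle⟩)⟩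
        · exact Or.inl h
      exact Or.inr ⟨sub_nonpos.2 (mul_pow_le_mul_pow_of_mem_cell hq hc' hx),
        sub_nonpos.2 (mul_pow_le_mul_pow_of_mem_cell hq hc' hy)⟩

theorem isExtreme_treeSimplex_inter {t : ℝ} (ht : 0 ≤ t) {T T' : SimpleGraph (Fin (n + 1))}
    (hT : T.IsTree) (hT' : T'.IsTree) :
    IsExtreme ℝ (treeSimplex T t) (treeSimplex T t ∩ treeSimplex T' t) := by
  have hq : 0 < 1 + t := by linarith
  obtain ⟨ρ, μ, _, h⟩ := exists_hasCode hT
  obtain ⟨ρ', μ', _, h'⟩ := exists_hasCode hT'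
  rw [h.treeSimplex_eq_cell hq, h'.treeSimplex_eq_cell hq]
  exact isExtreme_cell_inter ρ ρ' μ μ' (by linarith)

/-! ### The triangulation and the volume of the polytope. -/

theorem isTriangulation_cayleyPolytope {t : ℝ} (ht : 0 < t) :
    IsTriangulation (fun T : {T : SimpleGraph (Fin (n + 1)) // T.IsTree} => treeSimplex T.1 t)
      (cayleyPolytope n t) where
  finite := inferInstance
  simplex := by
    rintro ⟨T, hT⟩
    obtain ⟨ρ, μ, _, h⟩ := exists_hasCode hT
    simp only
    rw [h.treeSimplex_eq_preimage (by linarith)]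
    exact (isSimplex_orderSimplex ht).preimage _
  iUnion_eq := iUnion_treeSimplex ht
  disjoint_interior := by
    rintro ⟨T, hT⟩ ⟨T', hT'⟩ hne
    have hnull := volume_treeSimplex_inter ht hT hT' (fun h => hne (Subtype.ext h))
    have hopen : IsOpen (interior (treeSimplex T t) ∩ interior (treeSimplex T' t)) :=
      isOpen_interior.inter isOpen_interior
    exact Set.disjoint_iff_inter_eq_empty.2 ((hopen.measure_eq_zero_iff volume).1
      (measure_mono_null (Set.inter_subset_inter interior_subset interior_subset) hnull))
  inter_face := by
    rintro ⟨T, hT⟩ ⟨T', hT'⟩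
    refine ⟨isExtreme_treeSimplex_inter ht.le hT hT', ?_⟩
    rw [Set.inter_comm]
    exact isExtreme_treeSimplex_inter ht.le hT' hT

theorem measurableSet_treeSimplex {t : ℝ} (ht : 0 ≤ t) {T : SimpleGraph (Fin (n + 1))}
    (hT : T.IsTree) : MeasurableSet (treeSimplex T t) := by
  obtain ⟨ρ, μ, _, h⟩ := exists_hasCode hT
  rw [h.treeSimplex_eq_preimage (by linarith)]
  exact (LinearMap.continuous_on_pi (permScale ρ.symm _ _).toLinearMap).measurable
    (measurableSet_orderSimplex n t)

theorem factorial_mul_volume_cayleyPolytope_of_pos {t : ℝ} (ht : 0 < t) :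
    (n ! : ℝ≥0∞) * volume (cayleyPolytope n t) =
      ENNReal.ofReal (connectedEdgeSum n t (fun _ => True)) := by
  classical
  have hpos : 0 < 1 + t := by linarith
  have hvol := measure_iUnion₀ (μ := (volume : Measure (Fin n → ℝ)))
    (f := fun T : {T : SimpleGraph (Fin (n + 1)) // T.IsTree} => treeSimplex T.1 t)
    (fun T T' hne => volume_treeSimplex_inter ht T.2 T'.2 (fun h => hne (Subtype.ext h)))
    (fun T => (measurableSet_treeSimplex ht.le T.2).nullMeasurableSet)
  rw [iUnion_treeSimplex ht, tsum_fintype] at hvol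
  rw [hvol, Finset.mul_sum, connectedEdgeSum_eq_sum, ENNReal.ofReal_sum_of_nonneg]
  · refine Finset.sum_congr rfl (fun T _ => ?_)
    rw [factorial_mul_volume_treeSimplex T.2 ht.le, connectedEdgeSum_fiber T.2]
  · intro T _
    rw [connectedEdgeSum_fiber T.2]
    positivity

/-- The covering by simplices needs `t > 0`. At `t = 0` the polytope lies in the hyperplane where
the first coordinate is 1, and each tree contributes `0 ^ n = 0`, unless `n = 0`, where both sides
are 1. -/
theorem factorial_mul_volume_cayleyPolytope_zero :
    (n ! : ℝ≥0∞) * volume (cayleyPolytope n 0) =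
      ENNReal.ofReal (connectedEdgeSum n 0 (fun _ => True)) := by
  classical
  rcases n with _ | n
  · rw [connectedEdgeSum_eq_sum]
    have h1 : ∀ T : {T : SimpleGraph (Fin (0 + 1)) // T.IsTree},
        connectedEdgeSum 0 0 (fun G => searchTree G = T.1) = 1 := by
      intro T
      rw [connectedEdgeSum_fiber T.2]
      simp
    have : Subsingleton (Fin (0 + 1)) := Fin.subsingleton_one
    have hT : (⊥ : SimpleGraph (Fin (0 + 1))).IsTree := SimpleGraph.IsTree.of_subsingleton
    let _ : Unique {T : SimpleGraph (Fin (0 + 1)) // T.IsTree} :=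
      ⟨⟨⊥, hT⟩, fun T => Subtype.ext (by ext a b; simp [Subsingleton.elim a b])⟩
    have huniv : cayleyPolytope 0 0 = Set.univ :=
      Set.eq_univ_of_forall fun _ i => i.elim0
    simp only [h1, huniv, Finset.univ_unique, Finset.sum_singleton, ENNReal.ofReal_one]
    simp [volume_pi]
  · have hnull : volume (cayleyPolytope (n + 1) 0) = 0 := by
      refine measure_mono_null (fun x hx => ?_) (volume_coord_eq 1 (0 : Fin (n + 1)))
      have h := hx 0
      simp only [Fin.val_zero, coord] at h
      exact le_antisymm (by linarith [h.2]) h.1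
    rw [hnull, mul_zero, connectedEdgeSum_eq_sum, Finset.sum_eq_zero, ENNReal.ofReal_zero]
    intro T _
    rw [connectedEdgeSum_fiber T.2]
    simp

end CayleyPolytope

theorem theorem6p1 (n : ℕ) (t : ℝ) (ht : 0 ≤ t) :
    (∀ T : SimpleGraph (Fin (n + 1)), T.IsTree →
      (∃ d : ℕ, CayleyPolytope.IsSimplex d (CayleyPolytope.treeSimplex T t)) ∧
      (0 < t → CayleyPolytope.IsSimplex n (CayleyPolytope.treeSimplex T t)) ∧
      (n ! : ℝ≥0∞) * volume (CayleyPolytope.treeSimplex T t) =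
        ENNReal.ofReal
          (CayleyPolytope.connectedEdgeSum n t (fun G => CayleyPolytope.searchTree G = T)) ∧
      CayleyPolytope.connectedEdgeSum n t (fun G => CayleyPolytope.searchTree G = T) =
        t ^ n * (1 + t) ^ CayleyPolytope.alpha T) ∧
    (0 < t → CayleyPolytope.IsTriangulation
      (fun T : {T : SimpleGraph (Fin (n + 1)) // T.IsTree} => CayleyPolytope.treeSimplex T.1 t)
      (CayleyPolytope.cayleyPolytope n t)) ∧
    (n ! : ℝ≥0∞) * volume (CayleyPolytope.cayleyPolytope n t) =
      ENNReal.ofReal (CayleyPolytope.connectedEdgeSum n t (fun _ => True)) := by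
  refine ⟨fun T hT => ⟨?_, fun ht' => ?_, ?_, CayleyPolytope.connectedEdgeSum_fiber hT t⟩,
    CayleyPolytope.isTriangulation_cayleyPolytope, ?_⟩
  · obtain ⟨ρ, μ, _, h⟩ := CayleyPolytope.exists_hasCode hT
    obtain ⟨d, hd⟩ := CayleyPolytope.exists_isSimplex_orderSimplex (n := n) ht
    rw [h.treeSimplex_eq_preimage (by linarith)]
    exact ⟨d, hd.preimage _⟩
  · exact (CayleyPolytope.isTriangulation_cayleyPolytope ht').simplex ⟨T, hT⟩
  · rw [CayleyPolytope.factorial_mul_volume_treeSimplex hT ht,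
      CayleyPolytope.connectedEdgeSum_fiber hT t]
  · rcases ht.eq_or_lt with rfl | ht'
    · exact CayleyPolytope.factorial_mul_volume_cayleyPolytope_zero
    · exact CayleyPolytope.factorial_mul_volume_cayleyPolytope_of_pos ht'
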